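/- Conventions. Let $n,d,q,L\ge 1$. $\mathcal G_{n,d,q}$ is the set of graphs on $n$ vertices with all degrees at most $q$ and vertex labels in a $d$-element set, encoded as one-hot vectors in $\mathbb R^d$. For a graph $G$ with vertex attributes in $\mathbb R^d$, let $F_{G,L}$ be the disjoint union over the vertices $u$ of the depth-$L$ unrolling trees of $G$ at $u$ (levels $0,\dots,L$; below each copy of $v$ hang copies of the neighbours of $v$), where every vertex above level $L$ is padded with children of attribute $\vec 0$ so that it has exactly $n-1$ children. The Forest distance is $\mathrm{FD}_L(G,H)=\min_\varphi\sum_{x\in V(F_{G,L})}\|a(x)-a(\varphi(x))\|_2$, over all bijections $\varphi:V(F_{G,L})\to V(F_{H,L})$ preserving the parent–child relation. Two graphs are $\mathrm{WL}_L$-equivalent if in each of the iterations $0,\dots,L$ of color refinement every color occurs equally often in both; $[G]_L$ is the class of $G$ and $m_{n,d,q,L}$ is the number of classes on $\mathcal G_{n,d,q}$. $\mathcal N(X,\mathrm{dist},\varepsilon)$ is the least size of a subset $C\subseteq X$ such that every $x\in X$ has some $y\in C$ with $\mathrm{dist}(x,y)\le\varepsilon$. Put $$b(d,q,L)=2q^L\,\frac{1-q^L}{1-q}=2q^L\,(1+q+\dots+q^{L-1}),$$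 the last expression being the definition for $q=1$. Proposition. (a) If $G,H\in\mathcal G_{n,d,q}$ and $G$ arises from $H$ by deleting one edge, then $\mathrm{FD}_L(G,H)\le b(d,q,L)$. If $G$ arises from $H$ by changing the label of one vertex, then $\mathrm{FD}_L(G,H)\le\sqrt2\sum_{l=0}^{L}q^l$, and also $\mathrm{FD}_L(G,H)\le b(d,q,L)$ unless $(q,L)\in\{(1,1),(1,2),(2,1)\}$. (b) There is a tree whose vertices are the $m_{n,d,q,L}$ classes $[G]_L$, such that adjacent classes have representatives that differ by one edge deletion, one edge insertion or one label change, $\mathrm{FD}_L(G,H)\le b(d,q,L)$ whenever $[G]_L,[H]_L$ are adjacent, and $\mathrm{FD}_L(G,H)\le 2b(d,q,L)$ whenever $[G]_L,[H]_L$ have a common neighbour (in particular, for any choice of root, when they are siblings). (c) For every integer $k\ge 0$ with $k+1\le m_{n,d,q,L}$, $$\mathcal N\bigl(\mathcal G_{n,d,q},\mathrm{FD}_L,2b(d,q,L)k\bigr)\le\frac{m_{n,d,q,L}}{k+1}.$$ (d) Consider $L$-layer networks with $h_v^{(0)}=a(v)$, $$h_v^{(t)}=\varphi_t\Bigl(h_v^{(t-1)}W_t^{(1)}+\sum_{u\in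 N(v)}h_u^{(t-1)}W_t^{(2)}\Bigr),\qquad h_G=\psi\Bigl(\tfrac1n\sum_u h_u^{(L)}\Bigr),$$ of arbitrary widths, where $\varphi_t$ is $L_{\varphi_t}$-Lipschitz with $\varphi_t(0)=0$, $\psi$ is $L_\psi$-Lipschitz, and the matrices $W_t^{(i)}$ have operator norm at most $B$. For all $L$ and $B$ there is a constant $C(L)=C(L,B)\ge 0$, independent of everything else, such that the following holds with $C_{\mathrm{FD}_L}=C(L)L_\psi\prod_{t=1}^L L_{\varphi_t}$. First, $\|h_G-h_H\|_2\le\frac1n C_{\mathrm{FD}_L}\mathrm{FD}_L(G,H)$ for all graphs $G,H$ of order $n$ with attributes in $\mathbb R^d$ and all such networks. Second, let $\mathcal H=\mathsf{MPNN}^{\mathrm{sum}}_{L,M',L_{\mathsf{FNN}}}(\mathcal G_{n,d,q})$ be the class of all functions $h(G)=\mathsf{FNN}(h_G)$ on $\mathcal G_{n,d,q}$ with $|h|\le M'$, where $h_G$ comes from such a network and $\mathsf{FNN}(x)=\sigma(\cdots\sigma(\sigma(xW^{(1)})W^{(2)})\cdots W^{(r)})$, for some $r\ge1$ and activation $\sigma$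 applied componentwise, is a feed-forward network that is $L_{\mathsf{FNN}}$-Lipschitz. Let $\ell(x,y)=-\bigl(y\log\sigma_0(x)+(1-y)\log(1-\sigma_0(x))\bigr)$, $y\in\{0,1\}$, be the binary cross-entropy loss ($\sigma_0$ the sigmoid), let $\ell(\cdot,y)$ be $L_\ell$-Lipschitz for both $y$, let $M$ satisfy $|\ell(h(G),y)|\le M$ for all $h\in\mathcal H$, $G$, $y$, and let $\widetilde C=\frac2nL_\ell L_{\mathsf{FNN}}C_{\mathrm{FD}_L}$. Then for every probability distribution $\mu$ on $\mathcal G_{n,d,q}\times\{0,1\}$, every sample size $|\mathcal S|\ge1$, every learning algorithm $\mathcal S\mapsto h_{\mathcal S}\in\mathcal H$, every $\delta\in(0,1)$ and every integer $k\ge0$ with $k+1\le m_{n,d,q,L}$, with probability at least $1-\delta$ over an i.i.d. sample $\mathcal S$ from $\mu$, $$\bigl|\ell_{\exp}(h_{\mathcal S})-\ell_{\mathrm{emp}}(h_{\mathcal S})\bigr|\le 2\widetilde C\,b(d,q,L)\,k+M\sqrt{\frac{\frac{m_{n,d,q,L}}{k+1}\,4\log 2+2\log(1/\delta)}{|\mathcal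 S|}},$$ where $\ell_{\exp}$ and $\ell_{\mathrm{emp}}$ are the expectation of $\ell(h_{\mathcal S}(G),y)$ under $\mu$ and its mean over the sample. -/

import Mathlib

open MeasureTheory
open scoped NNReal Matrix

namespace ForestGen

noncomputable section

/-! ### Graphs -/

/-- An attributed graph of order `n` with `d`-dimensional real vertex features. -/
structure AttrGraph (n d : ℕ) where
  graph : SimpleGraph (Fin n)
  attr : Fin n → EuclideanSpace ℝ (Fin d)

/-- The class `𝒢_{n,d,q}`: graphs of order `n`, vertex labels from a set of `d` elements,
all degrees at most `q`. -/
@[ext] structure LabeledGraph (n d q : ℕ) where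
  graph : SimpleGraph (Fin n)
  label : Fin n → Fin d
  degree_le : ∀ v, (graph.neighborSet v).ncard ≤ q

/-- Labels are encoded as one-hot vectors. -/
def LabeledGraph.toAttr {n d q : ℕ} (G : LabeledGraph n d q) : AttrGraph n d where
  graph := G.graph
  attr v := EuclideanSpace.single (G.label v) 1

instance (n d q : ℕ) : Finite (LabeledGraph n d q) :=
  Finite.of_injective (fun G : LabeledGraph n d q => (G.graph, G.label)) (by
    intro G H h
    simp only [Prod.mk.injEq] at h
    exact LabeledGraph.ext h.1 h.2)

/-- The graph class is finite; every subset is an event. -/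
instance (n d q : ℕ) : MeasurableSpace (LabeledGraph n d q) := ⊤

/-- `G` is obtained from `H` by deleting one edge. -/
def IsEdgeDeletion {n d q : ℕ} (G H : LabeledGraph n d q) : Prop :=
  (∃ e ∈ H.graph.edgeSet, G.graph = H.graph.deleteEdges {e}) ∧ G.label = H.label

/-- `G` is obtained from `H` by changing the label of one vertex. -/
def IsLabelChange {n d q : ℕ} (G H : LabeledGraph n d q) : Prop :=
  G.graph = H.graph ∧ ∃ (v : Fin n) (c : Fin d), G.label = Function.update H.label v c

/-! ### The Forest distance

The padded unrolling tree of depth `L` at `u` has `n - 1` children below every vertex that is not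
at the last level.  Below a (genuine) copy of `v`, we index these `n - 1` children by the vertices
`w ≠ v`: the child `w` is a copy of `w` if `w ∈ N(v)`, and a padding vertex otherwise; all
descendants of a padding vertex are padding vertices.  So the vertices of the padded forest are the
words `v₀ v₁ ⋯ v_l` with `l ≤ L` and `v_i ≠ v_{i+1}`; such a word is genuine if it is a walk in the
graph, and then carries the attribute of its end point; otherwise it is padding and carries `0`. -/

/-- Vertices of the padded forest of depth `L`, as words listed from the last letter `v_l` to the
first letter `v₀` (the root of the tree which contains the vertex). -/
def ForestVertex (n L : ℕ) : Type :=
  {w : List (Fin n) // w ≠ [] ∧ w.length ≤ L + 1 ∧ w.IsChain (· ≠ ·)}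

instance (n L : ℕ) : Finite (ForestVertex n L) :=
  Set.Finite.to_subtype (s := {w : List (Fin n) | w ≠ [] ∧ w.length ≤ L + 1 ∧ w.IsChain (· ≠ ·)})
    ((List.finite_length_le (Fin n) (L + 1)).subset (fun _ h => h.2.1))

instance (n L : ℕ) : Fintype (ForestVertex n L) := Fintype.ofFinite _

/-- `y` is a child of `x` in the padded forest. -/
def IsChild {n L : ℕ} (x y : ForestVertex n L) : Prop := ∃ v : Fin n, y.1 = v :: x.1

open Classical in
/-- Attribute of a vertex of the padded forest `F_{G,L}`. -/
def forestAttr {n d : ℕ} (G : AttrGraph n d) (L : ℕ) (x : ForestVertex n L) :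
    EuclideanSpace ℝ (Fin d) :=
  if x.1.IsChain G.graph.Adj then G.attr (x.1.head x.2.1) else 0

/-- Edge-preserving bijections of the padded (rooted) forests. -/
def ForestIso (n L : ℕ) : Type :=
  {φ : ForestVertex n L ≃ ForestVertex n L // ∀ x y, IsChild x y ↔ IsChild (φ x) (φ y)}

/-- The Forest distance `FD_L` (weights `ω ≡ 1`); the infimum is a minimum over a finite set. -/
def forestDist {n d : ℕ} (L : ℕ) (G H : AttrGraph n d) : ℝ :=
  ⨅ φ : ForestIso n L, ∑ x : ForestVertex n L, ‖forestAttr G L x - forestAttr H L (φ.1 x)‖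

/-- `FD_L` on the class of labeled graphs. -/
def FD {n d q : ℕ} (L : ℕ) (G H : LabeledGraph n d q) : ℝ := forestDist L G.toAttr H.toAttr

/-- The constant `b(d,q,L) = 2 q^L (1 - q^L) / (1 - q)` (it does not depend on `d`), the quotient
being read as the geometric sum `1 + q + ⋯ + q^(L-1)`. -/
def editBound (q L : ℕ) : ℝ := 2 * (q : ℝ) ^ L * ∑ i ∈ Finset.range L, (q : ℝ) ^ i

theorem editBound_eq (q L : ℕ) (hq : q ≠ 1) :
    editBound q L = 2 * (q : ℝ) ^ L * ((1 - (q : ℝ) ^ L) / (1 - q)) := by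
  have h : (q : ℝ) ≠ 1 := by exact_mod_cast hq
  rw [editBound, geom_sum_eq h, ← neg_sub (1 : ℝ) ((q : ℝ) ^ L), ← neg_sub (1 : ℝ) (q : ℝ),
    neg_div_neg_eq]

/-! ### The 1-dimensional Weisfeiler--Leman algorithm -/

/-- Colors used in iteration `t`: the pair itself serves as its own (injective) relabeling. -/
def WLColor (d : ℕ) : ℕ → Type
  | 0 => Fin d
  | t + 1 => WLColor d t × Multiset (WLColor d t)

open Classical in
/-- The vertex coloring computed in iteration `t`. -/
def wlColor {n d q : ℕ} (G : LabeledGraph n d q) : (t : ℕ) → Fin n → WLColor d t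
  | 0, v => G.label v
  | t + 1, v => (wlColor G t v,
      (Finset.univ.filter (fun u => G.graph.Adj v u)).val.map (wlColor G t))

/-- The `1`-WL does not distinguish `G` and `H` within `L` iterations: in each of them, every color
occurs equally often in both graphs. -/
def WLIndist {n d q : ℕ} (L : ℕ) (G H : LabeledGraph n d q) : Prop :=
  ∀ t ≤ L, (Finset.univ : Finset (Fin n)).val.map (wlColor G t) =
    (Finset.univ : Finset (Fin n)).val.map (wlColor H t)

def wlSetoid (n d q L : ℕ) : Setoid (LabeledGraph n d q) where
  r := WLIndist L
  iseqv := ⟨fun _ _ _ => rfl, fun h t ht => (h t ht).symm,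
    fun h₁ h₂ t ht => (h₁ t ht).trans (h₂ t ht)⟩

/-- The quotient of `𝒢_{n,d,q}` by indistinguishability after `L` iterations. -/
abbrev WLClass (n d q L : ℕ) : Type := Quotient (wlSetoid n d q L)

/-- The class `[G]_L`. -/
def wlClass {n d q : ℕ} (L : ℕ) (G : LabeledGraph n d q) : WLClass n d q L :=
  Quotient.mk (wlSetoid n d q L) G

/-- `m_{n,d,q,L}`. -/
def numWLClasses (n d q L : ℕ) : ℕ := Nat.card (WLClass n d q L)

/-! ### Covering numbers -/

/-- The least cardinality of an `ε`-cover. -/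
def coveringNumber {X : Type*} (dist : X → X → ℝ) (ε : ℝ) : ℕ :=
  sInf {m : ℕ | ∃ C : Finset X, C.card = m ∧ ∀ x, ∃ y ∈ C, dist x y ≤ ε}

/-! ### Message-passing networks with sum aggregation -/

/-- Row vector times matrix. -/
def rowMul {m p : ℕ} (W : Matrix (Fin m) (Fin p) ℝ) (x : EuclideanSpace ℝ (Fin m)) :
    EuclideanSpace ℝ (Fin p) :=
  WithLp.toLp 2 (x.ofLp ᵥ* W)

/-- Feature dimensions: `d` before the first layer, `width t` after layer `t + 1`. -/
def featDim (d : ℕ) (width : ℕ → ℕ) : ℕ → ℕ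
  | 0 => d
  | t + 1 => width t

/-- An MPNN architecture with sum aggregation, `L` layers and order-normalized readout, on graphs
with `d`-dimensional features.  Index `t` belongs to layer `t + 1`; only indices `t < L` are used.
The matrices map into an arbitrary dimension `mid t`, the domain of the update function. -/
structure SumMPNN (L d : ℕ) where
  width : ℕ → ℕ
  mid : ℕ → ℕ
  outDim : ℕ
  W₁ : (t : ℕ) → Matrix (Fin (featDim d width t)) (Fin (mid t)) ℝ
  W₂ : (t : ℕ) → Matrix (Fin (featDim d width t)) (Fin (mid t)) ℝ
  φ : (t : ℕ) → EuclideanSpace ℝ (Fin (mid t)) → EuclideanSpace ℝ (Fin (featDim d width (t + 1)))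
  ψ : EuclideanSpace ℝ (Fin (featDim d width L)) → EuclideanSpace ℝ (Fin outDim)

open Classical in
/-- The vertex features `h_v^{(t)}`. -/
def SumMPNN.feature {L d n : ℕ} (net : SumMPNN L d) (G : AttrGraph n d) :
    (t : ℕ) → Fin n → EuclideanSpace ℝ (Fin (featDim d net.width t))
  | 0, v => G.attr v
  | t + 1, v => net.φ t (rowMul (net.W₁ t) (net.feature G t v) +
      ∑ u ∈ Finset.univ.filter (fun u => G.graph.Adj v u), rowMul (net.W₂ t) (net.feature G t u))

/-- The graph representation `h_G`. -/
def SumMPNN.embed {L d n : ℕ} (net : SumMPNN L d) (G : AttrGraph n d) :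
    EuclideanSpace ℝ (Fin net.outDim) :=
  net.ψ ((1 / (n : ℝ)) • ∑ u : Fin n, net.feature G L u)

/-- Update functions are `Lφ t`-Lipschitz and map `0` to `0` (so that zero padding is neutral), the
readout function is `Lψ`-Lipschitz, and all weight matrices have operator norm at most `B`. -/
structure SumMPNN.Admissible {L d : ℕ} (net : SumMPNN L d) (Lφ : ℕ → ℝ≥0) (Lψ B : ℝ≥0) :
    Prop where
  lipschitz_φ : ∀ t < L, LipschitzWith (Lφ t) (net.φ t)
  φ_zero : ∀ t < L, net.φ t 0 = 0
  lipschitz_ψ : LipschitzWith Lψ net.ψ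
  norm_W₁ : ∀ t < L, ∀ x, ‖rowMul (net.W₁ t) x‖ ≤ B * ‖x‖
  norm_W₂ : ∀ t < L, ∀ x, ‖rowMul (net.W₂ t) x‖ ≤ B * ‖x‖

/-- A feed-forward network `ℝ^p → ℝ` with activation `act`, square hidden matrices and a final
matrix of size `p × 1`. -/
structure FNN (p : ℕ) where
  act : ℝ → ℝ
  hidden : List (Matrix (Fin p) (Fin p) ℝ)
  out : Fin p → ℝ

/-- `x ↦ σ(⋯ σ(σ(x W⁽¹⁾) W⁽²⁾) ⋯ W⁽ᴸ⁾)`. -/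
def FNN.eval {p : ℕ} (f : FNN p) (x : EuclideanSpace ℝ (Fin p)) : ℝ :=
  f.act ((f.hidden.foldl (fun (y : Fin p → ℝ) W j => f.act ((y ᵥ* W) j)) x.ofLp) ⬝ᵥ f.out)

/-- The class `MPNN^sum_{L,M',L_FNN}(𝒢_{n,d,q})` with Lipschitz constants `Lφ`, `Lψ` of the layer
and readout functions and weight bound `B`. -/
def MPNNSum (L : ℕ) (M' : ℝ) (Lfnn : ℝ≥0) (Lφ : ℕ → ℝ≥0) (Lψ B : ℝ≥0) (n d q : ℕ) :
    Set (LabeledGraph n d q → ℝ) :=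
  {h | ∃ net : SumMPNN L d, net.Admissible Lφ Lψ B ∧
    ∃ f : FNN net.outDim, LipschitzWith Lfnn f.eval ∧
      ∀ G, h G = f.eval (net.embed G.toAttr) ∧ |h G| ≤ M'}

/-! ### Supervised learning -/

/-- The binary cross-entropy loss; labels `false` and `true` stand for `0` and `1`. -/
def bce (x : ℝ) (y : Bool) : ℝ :=
  -((if y then 1 else 0) * Real.log (Real.sigmoid x) +
    (1 - (if y then 1 else 0)) * Real.log (1 - Real.sigmoid x))

def expLoss {X : Type*} [MeasurableSpace X] (μ : Measure (X × Bool)) (h : X → ℝ) : ℝ :=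
  ∫ z, bce (h z.1) z.2 ∂μ

def empLoss {X : Type*} {N : ℕ} (S : Fin N → X × Bool) (h : X → ℝ) : ℝ :=
  (1 / (N : ℝ)) * ∑ i, bce (h (S i).1) (S i).2

end

end ForestGen

namespace ForestGen

/-! All padded forests of order `n` have the same vertex set, the words without equal consecutive
letters; the graph only decides which words are walks and hence carry a nonzero attribute. So the
identity is an admissible bijection, and the cost of an edit is bounded by counting affected walks.
A label change affects the walks ending at the changed vertex. A deleted edge affects the walks that
use it; the endpoints keep degree at most `q - 1`, and Bernoulli's inequality turns the resulting
count into `editBound`.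

If color refinement does not separate two graphs, a level-by-level matching of equal colors gives a
forest isomorphism of cost zero (`FD_le_zero_of_wlIndist`), so bounds for representatives pass to
classes. Deleting all edges and then changing labels on edgeless graphs connects all classes;
`editGraph` allows only these label changes, as they cost at most `√2` and so avoid the exceptional
pairs `(q, L)`. A spanning tree gives the tree of classes. For the covering number, sort the classes
by distance from a root modulo `k + 1` and keep the smallest residue class
(`exists_dominating_finset`); each edge of a path costs at most `editBound`.

For networks, features are extended by zero to padding vertices, which `φ 0 = 0` makes consistent. A
layer multiplies the total feature difference over the forest by at most `2 * B * Lφ t`: one share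
for a vertex itself and one for its only parent. After `L` layers the roots remain
(`norm_embed_sub_le`). The generalization bound is then robustness in the sense of Xu and Mannor,
with one cell per cover element and binary label, combined with the Bretagnolle–Huber–Carol
inequality. -/

/-- Two functions on a finite type with the same multiset of values differ by a permutation. -/
theorem exists_perm_of_map_univ_eq {ι α : Type*} [Fintype ι] {f g : ι → α}
    (h : (Finset.univ : Finset ι).val.map f = (Finset.univ : Finset ι).val.map g) :
    ∃ σ : Equiv.Perm ι, ∀ i, f i = g (σ i) := by
  classical
  have hc : ∀ c, Fintype.card {i // f i = c} = Fintype.card {i // g i = c} := by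
    intro c
    have := congrArg (Multiset.count c) h
    rw [Multiset.count_map, Multiset.count_map] at this
    rw [Fintype.card_subtype, Fintype.card_subtype]
    simpa [Finset.card_def, Finset.filter_val, eq_comm] using this
  let e : ∀ c, {i // f i = c} ≃ {i // g i = c} := fun c => Fintype.equivOfCardEq (hc c)
  refine ⟨(Equiv.sigmaFiberEquiv f).symm.trans ((Equiv.sigmaCongrRight e).trans
    (Equiv.sigmaFiberEquiv g)), fun i => ?_⟩
  exact ((e (f i) ⟨i, rfl⟩).2).symm

/-! ### Isomorphisms of padded forests and the Forest distance as a pseudometric. -/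

namespace ForestIso

variable {n d L : ℕ}

/-- The identity of the padded forest. -/
def refl (n L : ℕ) : ForestIso n L := ⟨Equiv.refl _, fun _ _ => Iff.rfl⟩

/-- The inverse of an isomorphism of padded forests. -/
def symm (φ : ForestIso n L) : ForestIso n L :=
  ⟨φ.1.symm, fun x y => by simpa using (φ.2 (φ.1.symm x) (φ.1.symm y)).symm⟩

/-- The composition of isomorphisms of padded forests. -/
def trans (φ χ : ForestIso n L) : ForestIso n L :=
  ⟨φ.1.trans χ.1, fun x y => (φ.2 x y).trans (χ.2 _ _)⟩

end ForestIso

instance (n L : ℕ) : Nonempty (ForestIso n L) := ⟨ForestIso.refl n L⟩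

instance (n L : ℕ) : Finite (ForestIso n L) :=
  Finite.of_injective (fun φ : ForestIso n L => φ.1) fun _ _ h => Subtype.ext h

section ForestDist

variable {n d L : ℕ}

theorem forestDist_le (φ : ForestIso n L) (G H : AttrGraph n d) :
    forestDist L G H ≤ ∑ x : ForestVertex n L, ‖forestAttr G L x - forestAttr H L (φ.1 x)‖ :=
  ciInf_le (Set.finite_range _).bddBelow φ

theorem exists_forestDist_eq (G H : AttrGraph n d) : ∃ φ : ForestIso n L,
    ∑ x : ForestVertex n L, ‖forestAttr G L x - forestAttr H L (φ.1 x)‖ = forestDist L G H :=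
  exists_eq_ciInf_of_finite

theorem forestDist_comm (G H : AttrGraph n d) : forestDist L G H = forestDist L H G := by
  suffices h : ∀ G H : AttrGraph n d, forestDist L G H ≤ forestDist L H G from
    le_antisymm (h G H) (h H G)
  intro G H
  obtain ⟨φ, hφ⟩ := exists_forestDist_eq (L := L) H G
  rw [← hφ]
  refine (forestDist_le φ.symm G H).trans (le_of_eq ?_)
  rw [← Equiv.sum_comp φ.1]
  simp [ForestIso.symm, norm_sub_rev]

theorem forestDist_triangle (G H K : AttrGraph n d) :
    forestDist L G K ≤ forestDist L G H + forestDist L H K := by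
  obtain ⟨φ, hφ⟩ := exists_forestDist_eq (L := L) G H
  obtain ⟨χ, hχ⟩ := exists_forestDist_eq (L := L) H K
  rw [← hφ, ← hχ, ← Equiv.sum_comp φ.1 (fun x => ‖forestAttr H L x - forestAttr K L (χ.1 x)‖),
    ← Finset.sum_add_distrib]
  exact (forestDist_le (φ.trans χ) G K).trans
    (Finset.sum_le_sum fun x _ => norm_sub_le_norm_sub_add_norm_sub _ _ _)

/-- An isomorphism of padded forests preserves levels. -/
theorem ForestIso.length_eq (φ : ForestIso n L) (x : ForestVertex n L) :
    (φ.1 x).1.length = x.1.length := by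
  -- A parent is mapped to a parent, so no isomorphism can lower a level; equality follows by
  -- applying this to the inverse as well.
  have key : ∀ (χ : ForestIso n L) (m : ℕ) (x : ForestVertex n L), x.1.length = m + 1 →
      m + 1 ≤ (χ.1 x).1.length := by
    intro χ m
    induction m with
    | zero => exact fun x _ => List.length_pos_of_ne_nil (χ.1 x).2.1
    | succ m ih =>
      rintro ⟨w, h0, hl, hc⟩ hx
      obtain ⟨v, w, rfl⟩ := List.exists_cons_of_ne_nil h0
      simp only [List.length_cons, Nat.add_right_cancel_iff] at hx
      have hw : w ≠ [] := by rintro rfl; simp at hx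
      obtain ⟨u, hu⟩ := (χ.2 ⟨w, hw, by simp at hl; omega, hc.tail⟩ ⟨v :: w, h0, hl, hc⟩).1 ⟨v, rfl⟩
      have := ih ⟨w, hw, by simp at hl; omega, hc.tail⟩ hx
      rw [hu, List.length_cons]
      omega
  have h1 : ∀ (χ : ForestIso n L) (x : ForestVertex n L), x.1.length ≤ (χ.1 x).1.length := by
    intro χ x
    have := List.length_pos_of_ne_nil x.2.1
    have := key χ (x.1.length - 1) x (by omega)
    omega
  refine le_antisymm ?_ (h1 φ x)
  simpa [ForestIso.symm] using h1 φ.symm (φ.1 x)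

end ForestDist

/-! ### Forest distance zero inside a Weisfeiler–Leman class. -/

section RelabelWord

variable {n : ℕ}

/-- Letter substitutions along a word: `β t u u'` is used for the letters that follow `u` in a word
in which `u` was replaced by `u'`, with `t` decreasing from `L`. -/
def wordPerm (L : ℕ) (σ : Equiv.Perm (Fin n)) (β : ℕ → Fin n → Fin n → Equiv.Perm (Fin n)) :
    List (Fin n) → Equiv.Perm (Fin n)
  | [] => σ
  | u :: w => β (L - 1 - w.length) u (wordPerm L σ β w u)

/-- Replace each letter of a word by means of `wordPerm`. -/
def relabelWord (L : ℕ) (σ : Equiv.Perm (Fin n)) (β : ℕ → Fin n → Fin n → Equiv.Perm (Fin n)) :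
    List (Fin n) → List (Fin n)
  | [] => []
  | v :: w => wordPerm L σ β w v :: relabelWord L σ β w

variable {L : ℕ} {σ : Equiv.Perm (Fin n)} {β : ℕ → Fin n → Fin n → Equiv.Perm (Fin n)}

theorem length_relabelWord (w : List (Fin n)) : (relabelWord L σ β w).length = w.length := by
  induction w with
  | nil => rfl
  | cons v w ih => simp [relabelWord, ih]

/-- The permutation applied to the head depends only on the tail, so a word can be decoded from its
root upwards. -/
theorem relabelWord_injective : Function.Injective (relabelWord L σ β) := by
  intro w
  induction w with
  | nil =>
    intro w' h
    cases w' with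
    | nil => rfl
    | cons v' w' => simp [relabelWord] at h
  | cons v w ih =>
    intro w' h
    cases w' with
    | nil => simp [relabelWord] at h
    | cons v' w' =>
      simp only [relabelWord, List.cons.injEq] at h
      obtain rfl := ih h.2
      rw [(wordPerm L σ β w).injective h.1]

/-- The condition on `β` is exactly what is needed: since the permutation sends `u` to its
replacement `u'`, any letter other than `u` is sent to a letter other than `u'`. -/
theorem isChain_ne_relabelWord (hβ : ∀ t u u', β t u u' u = u') (w : List (Fin n))
    (hw : w.IsChain (· ≠ ·)) : (relabelWord L σ β w).IsChain (· ≠ ·) := by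
  induction w with
  | nil => simp [relabelWord]
  | cons v w ih =>
    cases w with
    | nil => simp [relabelWord]
    | cons u w =>
      rw [List.isChain_cons_cons] at hw
      have := ih hw.2
      simp only [relabelWord] at this ⊢
      rw [List.isChain_cons_cons]
      refine ⟨fun h => hw.1 ?_, this⟩
      apply (wordPerm L σ β (u :: w)).injective
      rw [h, wordPerm, hβ]

/-- The automorphism of the padded forest induced by `relabelWord`. -/
noncomputable def relabelIso (L : ℕ) (σ : Equiv.Perm (Fin n))
    (β : ℕ → Fin n → Fin n → Equiv.Perm (Fin n))
    (hβ : ∀ t u u', β t u u' u = u') : ForestIso n L :=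
  ⟨Equiv.ofBijective (fun x : ForestVertex n L => (⟨relabelWord L σ β x.1,
      by rw [← List.length_pos_iff, length_relabelWord, List.length_pos_iff]; exact x.2.1,
      by rw [length_relabelWord]; exact x.2.2.1,
      isChain_ne_relabelWord hβ _ x.2.2.2⟩ : ForestVertex n L))
    (Finite.injective_iff_bijective.1 fun x y h =>
      Subtype.ext (relabelWord_injective (congrArg Subtype.val h))), by
    rintro ⟨w, hw⟩ ⟨w', hw'⟩
    constructor
    · rintro ⟨v, rfl⟩
      exact ⟨_, rfl⟩
    · rintro ⟨v, hv⟩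
      change relabelWord L σ β w' = v :: relabelWord L σ β w at hv
      obtain ⟨u, z, rfl⟩ := List.exists_cons_of_ne_nil hw'.1
      simp only [relabelWord, List.cons.injEq] at hv
      exact ⟨u, congrArg (u :: ·) (relabelWord_injective hv.2)⟩⟩

end RelabelWord

variable {n d q : ℕ}

theorem label_eq_of_wlColor_eq {G H : LabeledGraph n d q} {t : ℕ} {v v' : Fin n}
    (h : wlColor G t v = wlColor H t v') : G.label v = H.label v' := by
  induction t with
  | zero => exact h
  | succ t ih => exact ih (congrArg Prod.fst h)

/-- Supplies the `β` for `relabelWord`. Equal colors at `t + 1` give a matching of the neighbors by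
color at `t`, and equal degrees let it extend to the non-neighbors, which index the padding
children. -/
theorem exists_neighbor_perm (G H : LabeledGraph n d q) (t : ℕ) (v v' : Fin n) :
    ∃ σ : Equiv.Perm (Fin n), σ v = v' ∧
      (wlColor G (t + 1) v = wlColor H (t + 1) v' → ∀ w, (G.graph.Adj w v ↔ H.graph.Adj (σ w) v') ∧
        (G.graph.Adj w v → wlColor G t w = wlColor H t (σ w))) := by
  classical
  by_cases hc : wlColor G (t + 1) v = wlColor H (t + 1) v'
  swap
  -- For unequal colors only `σ v = v'` is required, which keeps `β` total.
  · exact ⟨Equiv.swap v v', Equiv.swap_apply_left _ _, fun h => absurd h hc⟩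
  -- Three kinds of value separate the vertex itself, its neighbors (with their color) and the rest;
  -- a permutation matching these values respects all three.
  let F (K : LabeledGraph n d q) (x : Fin n) (w : Fin n) : Option (Option (WLColor d t)) :=
    if w = x then none else if K.graph.Adj x w then some (some (wlColor K t w)) else some none
  have hF : ∀ (K : LabeledGraph n d q) (x : Fin n),
      (Finset.univ : Finset (Fin n)).val.map (F K x) = none ::ₘ
        ((wlColor K (t + 1) x).2.map (fun c => some (some c)) +
          Multiset.replicate (n - 1 - (wlColor K (t + 1) x).2.card) (some none)) := by
    intro K x
    have h1 : (Finset.univ : Finset (Fin n)).val = x ::ₘ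
        ((Finset.univ.filter (fun u => K.graph.Adj x u)).val +
          ((Finset.univ.erase x).filter (fun u => ¬ K.graph.Adj x u)).val) := by
      have h2 : (Finset.univ.filter (fun u => K.graph.Adj x u)) =
          (Finset.univ.erase x).filter (fun u => K.graph.Adj x u) := by
        ext u
        simp only [Finset.mem_filter, Finset.mem_univ, true_and, Finset.mem_erase, and_true]
        exact ⟨fun h => ⟨h.ne', h⟩, fun h => h.2⟩
      rw [h2, Finset.filter_val, Finset.filter_val, Multiset.filter_add_not,
        Finset.erase_val, Multiset.cons_erase (Finset.mem_univ x)]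
    have h3 := congrArg Multiset.card h1
    simp only [Finset.card_val, Finset.card_univ, Fintype.card_fin, Multiset.card_cons,
      Multiset.card_add] at h3
    rw [h1, Multiset.map_cons, Multiset.map_add]
    congr 1
    · simp [F]
    congr 1
    · rw [wlColor, Multiset.map_map]
      refine Multiset.map_congr rfl fun u hu => ?_
      have hu : K.graph.Adj x u := by
          rw [Finset.mem_val] at hu
          simpa using hu
      simp [F, hu, hu.ne']
    · rw [Multiset.map_congr (g := fun _ => some none) rfl, Multiset.map_const']
      · congr 1
        simp only [wlColor, Multiset.card_map, Finset.card_val]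
        omega
      · intro u hu
        have hu : u ≠ x ∧ ¬ K.graph.Adj x u := by
          rw [Finset.mem_val] at hu
          simpa using hu
        simp [F, hu.1, hu.2]
  obtain ⟨σ, hσ⟩ := exists_perm_of_map_univ_eq (f := F G v) (g := F H v') (by rw [hF, hF, hc])
  have h0 : σ v = v' := by
    have := hσ v
    by_contra hne
    by_cases ha : H.graph.Adj v' (σ v) <;> simp [F, hne, ha] at this
  refine ⟨σ, h0, fun _ w => ?_⟩
  by_cases hw : w = v
  · subst hw
    simp [h0]
  have hw' : σ w ≠ v' := fun h => hw (σ.injective (h.trans h0.symm))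
  have := hσ w
  by_cases ha : G.graph.Adj v w <;> by_cases hb : H.graph.Adj v' (σ w) <;>
    simp [F, hw, hw', ha, hb] at this
  · simp [ha.symm, hb.symm, this]
  · rw [SimpleGraph.adj_comm] at ha hb
    simp [ha, hb]

/-- Graphs that are indistinguishable by color refinement have Forest distance zero. -/
theorem FD_le_zero_of_wlIndist {L : ℕ} {G H : LabeledGraph n d q} (h : WLIndist L G H) :
    FD L G H ≤ 0 := by
  classical
  obtain ⟨σ, hσ⟩ := exists_perm_of_map_univ_eq (h L le_rfl)
  choose β hβ hβ' using exists_neighbor_perm G H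
  -- One iteration is spent per level: a genuine vertex at level `w.length` is matched with one of
  -- equal color in iteration `L - w.length`, so its children can be matched in the iteration
  -- before.
  have key : ∀ (w : List (Fin n)) (u : Fin n), w.length ≤ L →
      ((u :: w).IsChain G.graph.Adj ↔ (relabelWord L σ β (u :: w)).IsChain H.graph.Adj) ∧
      ((u :: w).IsChain G.graph.Adj →
        wlColor G (L - w.length) u = wlColor H (L - w.length) (wordPerm L σ β w u)) := by
    intro w
    induction w with
    | nil => simpa [relabelWord, wordPerm] using hσ
    | cons u w ih =>
      intro v hl
      simp only [List.length_cons] at hl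
      obtain ⟨ih1, ih2⟩ := ih u (by omega)
      simp only [relabelWord, List.isChain_cons_cons, List.length_cons] at ih1 ⊢
      rw [← ih1]
      by_cases hg : (u :: w).IsChain G.graph.Adj
      · have hc := ih2 hg
        obtain ⟨t, ht⟩ : ∃ t, L - w.length = t + 1 := ⟨L - w.length - 1, by omega⟩
        have ht' : L - 1 - w.length = t := by omega
        have ht'' : L - (w.length + 1) = t := by omega
        rw [ht] at hc
        have := hβ' t u (wordPerm L σ β w u) hc v
        rw [ht'']
        simp only [hg, and_true, wordPerm, ht']
        exact this
      · simp [hg]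
  have hD := forestDist_le (relabelIso L σ β hβ) G.toAttr H.toAttr
  refine hD.trans (Finset.sum_nonpos fun x _ => ?_)
  obtain ⟨w, h0, hl, hc⟩ := x
  obtain ⟨u, w, rfl⟩ := List.exists_cons_of_ne_nil h0
  obtain ⟨k1, k2⟩ := key w u (by simpa using hl)
  suffices hs : forestAttr G.toAttr L ⟨u :: w, h0, hl, hc⟩ =
      forestAttr H.toAttr L ((relabelIso L σ β hβ).1 ⟨u :: w, h0, hl, hc⟩) by simp [hs]
  simp only [forestAttr, relabelIso]
  change (if (u :: w).IsChain G.graph.Adj then EuclideanSpace.single (G.label u) (1 : ℝ) else 0) =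
    if (relabelWord L σ β (u :: w)).IsChain H.graph.Adj then
      EuclideanSpace.single (H.label (wordPerm L σ β w u)) (1 : ℝ) else 0
  by_cases hg : (u :: w).IsChain G.graph.Adj
  · rw [if_pos hg, if_pos (k1.1 hg), label_eq_of_wlColor_eq (k2 hg)]
  · rw [if_neg hg, if_neg (fun h => hg (k1.2 h))]

/-- The identity need not be optimal, but it suffices for both kinds of edit. -/
theorem forestDist_le_sum {n d L : ℕ} (G H : AttrGraph n d) :
    forestDist L G H ≤ ∑ x : ForestVertex n L, ‖forestAttr G L x - forestAttr H L x‖ :=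
  forestDist_le (ForestIso.refl n L) G H

open Classical in
theorem forestAttr_cons {n d L : ℕ} (G : AttrGraph n d) (u : Fin n) (w : List (Fin n))
    (h : u :: w ≠ [] ∧ (u :: w).length ≤ L + 1 ∧ (u :: w).IsChain (· ≠ ·)) :
    forestAttr G L ⟨u :: w, h⟩ = if (u :: w).IsChain G.graph.Adj then G.attr u else 0 := rfl

/-! ### Summation over words and counting of walks. -/

section WordSum

variable {n : ℕ}

/-- The sum of a function over all words of a given length. -/
def wordSum {n : ℕ} : ℕ → (List (Fin n) → ℝ) → ℝ
  | 0, g => g []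
  | l + 1, g => ∑ v, wordSum l fun w => g (v :: w)

theorem wordSum_mono {l : ℕ} {f g : List (Fin n) → ℝ} (h : ∀ w, f w ≤ g w) :
    wordSum l f ≤ wordSum l g := by
  induction l generalizing f g with
  | zero => exact h []
  | succ l ih => exact Finset.sum_le_sum fun v _ => ih fun w => h (v :: w)

theorem wordSum_mul_left (l : ℕ) (c : ℝ) (g : List (Fin n) → ℝ) :
    wordSum l (fun w => c * g w) = c * wordSum l g := by
  induction l generalizing g with
  | zero => rfl
  | succ l ih => simp only [wordSum, ih, Finset.mul_sum]

theorem wordSum_add (l : ℕ) (f g : List (Fin n) → ℝ) :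
    wordSum l (fun w => f w + g w) = wordSum l f + wordSum l g := by
  induction l generalizing f g with
  | zero => rfl
  | succ l ih => simp only [wordSum, ih, Finset.sum_add_distrib]

theorem wordSum_nonneg {l : ℕ} {g : List (Fin n) → ℝ} (h : ∀ w, 0 ≤ g w) : 0 ≤ wordSum l g := by
  have := wordSum_mul_left l 0 g
  rw [zero_mul] at this
  rw [← this]
  exact wordSum_mono fun w => by simpa using h w

/-- The words of a given length. -/
def words (n : ℕ) : ℕ → Finset (List (Fin n))
  | 0 => {[]}
  | l + 1 => (Finset.univ ×ˢ words n l).map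
      ⟨fun p : Fin n × List (Fin n) => p.1 :: p.2, fun p p' h => by
        simp only [List.cons.injEq] at h
        exact Prod.ext h.1 h.2⟩

theorem mem_words (w : List (Fin n)) : w ∈ words n w.length := by
  induction w with
  | nil => simp [words]
  | cons v w ih =>
    exact Finset.mem_map.2 ⟨(v, w), Finset.mem_product.2 ⟨Finset.mem_univ v, ih⟩, rfl⟩

theorem sum_words (l : ℕ) (g : List (Fin n) → ℝ) : ∑ w ∈ words n l, g w = wordSum l g := by
  induction l generalizing g with
  | zero => simp [words, wordSum]
  | succ l ih =>
    rw [words, wordSum, Finset.sum_map, Finset.sum_product]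
    exact Finset.sum_congr rfl fun v _ => ih fun w => g (v :: w)

/-- Level `l` of the forest consists of words with `l + 1` letters; dropping the requirement that
consecutive letters differ only adds nonnegative terms. -/
theorem sum_forestVertex_le {L : ℕ} {g : List (Fin n) → ℝ} (h : ∀ w, 0 ≤ g w) :
    ∑ x : ForestVertex n L, g x.1 ≤ ∑ l ∈ Finset.range (L + 1), wordSum (l + 1) g := by
  classical
  rw [← Finset.sum_fiberwise_of_maps_to (s := Finset.univ) (t := Finset.range (L + 1))
    (g := fun x : ForestVertex n L => x.1.length - 1)]
  swap
  · intro x _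
    have := x.2.2.1
    rw [Finset.mem_range]
    omega
  refine Finset.sum_le_sum fun l _ => ?_
  rw [← sum_words]
  have hi : Function.Injective (fun x : ForestVertex n L => x.1) := Subtype.val_injective
  rw [← Finset.sum_image (f := g) (hi.injOn)]
  refine Finset.sum_le_sum_of_subset_of_nonneg ?_ fun w _ _ => h w
  intro w hw
  obtain ⟨x, hx, rfl⟩ := Finset.mem_image.1 hw
  have h1 := List.length_pos_of_ne_nil x.2.1
  have h2 := (Finset.mem_filter.1 hx).2
  have h3 := mem_words x.1
  rwa [show x.1.length = l + 1 by omega] at h3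

end WordSum

section Walks

variable {n : ℕ}

open Classical in
/-- The indicator function of the walks of a graph. -/
noncomputable def walkInd (G : SimpleGraph (Fin n)) (w : List (Fin n)) : ℝ :=
  if w.IsChain G.Adj then 1 else 0

theorem walkInd_nonneg (G : SimpleGraph (Fin n)) (w : List (Fin n)) : 0 ≤ walkInd G w := by
  unfold walkInd; split_ifs <;> norm_num

open Classical in
theorem sum_adj_eq_ncard (G : SimpleGraph (Fin n)) (v : Fin n) :
    ∑ u, (if G.Adj v u then (1 : ℝ) else 0) = (G.neighborSet v).ncard := by
  rw [Finset.sum_boole, Set.ncard_eq_toFinset_card']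
  congr 2
  ext u
  simp

/-- The degree bound `r` concerns the end point alone. This allows `r = q - 1` at an endpoint of the
deleted edge while all other vertices keep `q`. -/
theorem wordSum_walkInd_succ_le {G : SimpleGraph (Fin n)} {v : Fin n} {r : ℕ} {l : ℕ} {c : ℝ}
    (hv : (G.neighborSet v).ncard ≤ r) (hc : 0 ≤ c)
    (h : ∀ u, wordSum l (fun w => walkInd G (u :: w)) ≤ c) :
    wordSum (l + 1) (fun w => walkInd G (v :: w)) ≤ r * c := by
  classical
  have h1 : ∀ u, wordSum l (fun w => walkInd G (v :: u :: w)) ≤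
      (if G.Adj v u then (1 : ℝ) else 0) * c := by
    intro u
    have : ∀ w, walkInd G (v :: u :: w) = (if G.Adj v u then (1 : ℝ) else 0) *
        walkInd G (u :: w) := by
      intro w
      by_cases h1 : G.Adj v u <;> simp [walkInd, List.isChain_cons_cons, h1]
    simp only [this, wordSum_mul_left]
    exact mul_le_mul_of_nonneg_left (h u) (by split_ifs <;> norm_num)
  refine (Finset.sum_le_sum fun u _ => h1 u).trans ?_
  rw [← Finset.sum_mul, sum_adj_eq_ncard]
  exact mul_le_mul_of_nonneg_right (by exact_mod_cast hv) hc

/-- In a graph of maximum degree at most `r`, at most `r ^ l` walks of length `l` end at `v`. -/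
theorem wordSum_walkInd_le {G : SimpleGraph (Fin n)} {r : ℕ}
    (hG : ∀ v, (G.neighborSet v).ncard ≤ r) (l : ℕ) (v : Fin n) :
    wordSum l (fun w => walkInd G (v :: w)) ≤ (r : ℝ) ^ l := by
  induction l generalizing v with
  | zero => simp [wordSum, walkInd]
  | succ l ih =>
    rw [pow_succ']
    exact wordSum_walkInd_succ_le (hG v) (by positivity) ih

end Walks

/-! ### The cost of a label change. -/

section LabelChange

variable {n d q : ℕ}

theorem norm_single_sub_single_le (a b : Fin d) :
    ‖(EuclideanSpace.single a 1 - EuclideanSpace.single b 1 : EuclideanSpace ℝ (Fin d))‖ ≤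
      Real.sqrt 2 := by
  apply Real.le_sqrt_of_sq_le
  rw [norm_sub_sq_real]
  rcases eq_or_ne a b with rfl | h
  · simp
    norm_num
  · simp [EuclideanSpace.inner_single_left, h]
    norm_num

/-- Only walks ending at the changed vertex contribute, each at most `√2`. The bound `r` is
independent of `q` so that edgeless graphs can use `r = 0`. -/
theorem FD_le_of_isLabelChange {L r : ℕ} {G H : LabeledGraph n d q} (h : IsLabelChange G H)
    (hG : ∀ v, (G.graph.neighborSet v).ncard ≤ r) :
    FD L G H ≤ Real.sqrt 2 * ∑ l ∈ Finset.range (L + 1), (r : ℝ) ^ l := by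
  classical
  obtain ⟨hg, v, c, hl⟩ := h
  let E : List (Fin n) → ℝ := fun w => Real.sqrt 2 * if w.head? = some v then walkInd G.graph w else 0
  have hE : ∀ w, 0 ≤ E w := by
    intro w
    have := walkInd_nonneg G.graph w
    simp only [E]
    split_ifs <;> positivity
  refine (forestDist_le_sum _ _).trans ?_
  refine (Finset.sum_le_sum (g := fun x : ForestVertex n L => E x.1) fun x _ => ?_).trans
    ((sum_forestVertex_le hE).trans ?_)
  · obtain ⟨w, h0, hw⟩ := x
    obtain ⟨u, w, rfl⟩ := List.exists_cons_of_ne_nil h0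
    simp only [forestAttr_cons, LabeledGraph.toAttr, E, walkInd, hg, hl, List.head?_cons,
      Option.some.injEq]
    by_cases h1 : (u :: w).IsChain H.graph.Adj
    · by_cases h2 : u = v
      · rw [if_pos h1, if_pos h1, if_pos h2, if_pos h1, mul_one]
        exact norm_single_sub_single_le _ _
      · rw [if_pos h1, if_pos h1, if_neg h2, Function.update_of_ne h2, sub_self, norm_zero, mul_zero]
    · simp [h1]
  · rw [Finset.mul_sum]
    refine Finset.sum_le_sum fun l _ => ?_
    simp only [E, wordSum_mul_left]
    refine mul_le_mul_of_nonneg_left ?_ (Real.sqrt_nonneg _)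
    simp only [wordSum, List.head?_cons, Option.some.injEq]
    rw [Finset.sum_eq_single v]
    · simpa using wordSum_walkInd_le hG l v
    · intro u _ hu
      simpa [hu] using wordSum_mul_left l 0 (fun _ => (0 : ℝ))
    · simp

/-- With `√2 ≤ 3/2`, the case `q = 1` reads `3/2 * (L + 1) ≤ 2 * L`, true from `L = 3` on. For `q ≥
2` the last power is at most `q` times the sum of the earlier ones, which leaves `3/2 * (1 + q) ≤ 2
* q ^ L`; this fails only at `(2, 1)`. -/
theorem sqrt_two_mul_sum_le_editBound {q L : ℕ} (hq : 1 ≤ q) (hL : 1 ≤ L) (h₁ : (q, L) ≠ (1, 1))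
    (h₂ : (q, L) ≠ (1, 2)) (h₃ : (q, L) ≠ (2, 1)) :
    Real.sqrt 2 * ∑ l ∈ Finset.range (L + 1), (q : ℝ) ^ l ≤ editBound q L := by
  simp only [ne_eq, Prod.mk.injEq] at h₁ h₂ h₃
  have hs : Real.sqrt 2 ≤ 3 / 2 := Real.sqrt_le_iff.2 ⟨by norm_num, by norm_num⟩
  refine (mul_le_mul_of_nonneg_right hs (by positivity)).trans ?_
  unfold editBound
  rcases Nat.eq_or_lt_of_le hq with rfl | hq2
  · have : (3 : ℝ) ≤ L := by exact_mod_cast (by omega : 3 ≤ L)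
    simp
    linarith
  have hq2' : (2 : ℝ) ≤ q := by exact_mod_cast hq2
  have hS : (q : ℝ) ^ L ≤ q * ∑ l ∈ Finset.range L, (q : ℝ) ^ l := by
    obtain ⟨K, rfl⟩ : ∃ K, L = K + 1 := ⟨L - 1, by omega⟩
    rw [pow_succ', Finset.sum_range_succ]
    have : 0 ≤ ∑ l ∈ Finset.range K, (q : ℝ) ^ l := by positivity
    nlinarith
  have hQ : 3 / 2 * (1 + (q : ℝ)) ≤ 2 * (q : ℝ) ^ L := by
    rcases Nat.eq_or_lt_of_le hL with rfl | hL2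
    · have : (3 : ℝ) ≤ q := by exact_mod_cast (by omega : 3 ≤ q)
      linarith
    · have : (q : ℝ) ^ 2 ≤ (q : ℝ) ^ L := pow_le_pow_right₀ (by linarith) hL2
      nlinarith
  rw [Finset.sum_range_succ]
  have hp : 0 ≤ ∑ l ∈ Finset.range L, (q : ℝ) ^ l := by positivity
  nlinarith [mul_le_mul_of_nonneg_right hQ hp]

end LabelChange

/-! ### The cost of an edge deletion. -/

section EdgeDeletion

variable {n d q : ℕ}

open Classical in
/-- The indicator function of the walks of `H` that are not walks of `G`. -/
noncomputable def lostWalkInd (G H : SimpleGraph (Fin n)) (w : List (Fin n)) : ℝ :=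
  if w.IsChain H.Adj ∧ ¬ w.IsChain G.Adj then 1 else 0

theorem lostWalkInd_nonneg (G H : SimpleGraph (Fin n)) (w : List (Fin n)) :
    0 ≤ lostWalkInd G H w := by
  unfold lostWalkInd; split_ifs <;> norm_num

/-- Look at the last step of a lost walk: either the walk was lost before it, with at most `q`
continuations, or a walk of `G` reaches `a` or `b` and then crosses the deleted edge. -/
theorem wordSum_lostWalkInd_succ_le {G H : SimpleGraph (Fin n)} {a b : Fin n}
    (hG : G = H.deleteEdges {s(a, b)}) (hH : ∀ v, (H.neighborSet v).ncard ≤ q) (l : ℕ) :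
    wordSum (l + 2) (lostWalkInd G H) ≤ q * wordSum (l + 1) (lostWalkInd G H) +
      wordSum l (fun w => walkInd G (a :: w)) + wordSum l (fun w => walkInd G (b :: w)) := by
  classical
  have h1 : ∀ v u w, lostWalkInd G H (v :: u :: w) ≤
      (if H.Adj u v then (1 : ℝ) else 0) * lostWalkInd G H (u :: w) +
      ((if v = b then (if u = a then 1 else 0) else 0) +
        (if v = a then (if u = b then 1 else 0) else 0)) * walkInd G (u :: w) := by
    intro v u w
    have e1 := lostWalkInd_nonneg G H (u :: w)
    have e2 := walkInd_nonneg G (u :: w)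
    by_cases hc : (v :: u :: w).IsChain H.Adj ∧ ¬ (v :: u :: w).IsChain G.Adj
    swap
    · rw [lostWalkInd, if_neg hc]
      positivity
    rw [lostWalkInd, if_pos hc]
    rw [List.isChain_cons_cons, List.isChain_cons_cons] at hc
    by_cases hw : (u :: w).IsChain G.Adj
    · have hG' : ¬ G.Adj v u := fun h => hc.2 ⟨h, hw⟩
      have he : s(v, u) = s(a, b) := by
        by_contra he
        apply hG'
        rw [hG, SimpleGraph.deleteEdges_adj]
        exact ⟨hc.1.1, he⟩
      have e3 : (1 : ℝ) ≤ ((if v = b then (if u = a then 1 else 0) else 0) +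
        (if v = a then (if u = b then 1 else 0) else 0)) := by
        rcases Sym2.eq_iff.1 he with ⟨rfl, rfl⟩ | ⟨rfl, rfl⟩
        · simp; split_ifs <;> norm_num
        · simp; split_ifs <;> norm_num
      have e4 : walkInd G (u :: w) = 1 := by simp [walkInd, hw]
      rw [e4, mul_one]
      have : 0 ≤ (if H.Adj u v then (1 : ℝ) else 0) * lostWalkInd G H (u :: w) := by positivity
      linarith
    · simp [lostWalkInd, walkInd, hw, hc.1.1.symm, hc.1.2]
  have h2 : wordSum (l + 2) (lostWalkInd G H) ≤ ∑ v, ∑ u,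
      ((if H.Adj u v then (1 : ℝ) else 0) * wordSum l (fun w => lostWalkInd G H (u :: w)) +
      ((if v = b then (if u = a then 1 else 0) else 0) +
        (if v = a then (if u = b then 1 else 0) else 0)) *
          wordSum l (fun w => walkInd G (u :: w))) := by
    refine Finset.sum_le_sum fun v _ => Finset.sum_le_sum fun u _ => ?_
    rw [← wordSum_mul_left, ← wordSum_mul_left, ← wordSum_add]
    exact wordSum_mono (h1 v u)
  refine h2.trans ?_
  simp only [Finset.sum_add_distrib, add_mul]
  rw [add_assoc]
  refine add_le_add ?_ (le_of_eq ?_)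
  · rw [Finset.sum_comm]
    simp only [← Finset.sum_mul, sum_adj_eq_ncard]
    simp only [wordSum, Finset.mul_sum]
    refine Finset.sum_le_sum fun u _ => mul_le_mul_of_nonneg_right (by exact_mod_cast hH u) ?_
    exact wordSum_nonneg fun w => lostWalkInd_nonneg G H _
  · congr 1
    · rw [Finset.sum_eq_single b, Finset.sum_eq_single a] <;> simp +contextual
    · rw [Finset.sum_eq_single a, Finset.sum_eq_single b] <;> simp +contextual

/-- Solves the recursion, using that `a` and `b` have degree at most `q - 1` in `G`. The factor `q`
on the left avoids the exponent `l - 1`. -/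
theorem wordSum_lostWalkInd_le {G H : SimpleGraph (Fin n)} {a b : Fin n} (hab : H.Adj a b)
    (hG : G = H.deleteEdges {s(a, b)}) (hq : 1 ≤ q) (hH : ∀ v, (H.neighborSet v).ncard ≤ q)
    (l : ℕ) : q * wordSum (l + 2) (lostWalkInd G H) ≤ 2 * (q : ℝ) ^ l * (q + l * (q - 1)) := by
  have hGH : ∀ v, G.neighborSet v ⊆ H.neighborSet v := by
    intro v u hu
    rw [hG] at hu
    exact (SimpleGraph.deleteEdges_adj.1 hu).1
  have hGq : ∀ v, (G.neighborSet v).ncard ≤ q := fun v =>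
    (Set.ncard_le_ncard (hGH v) (Set.toFinite _)).trans (hH v)
  have hlt : ∀ x y, H.Adj x y → ¬ G.Adj x y → (G.neighborSet x).ncard ≤ q - 1 := by
    intro x y h1 h2
    have : (G.neighborSet x).ncard < (H.neighborSet x).ncard :=
      Set.ncard_lt_ncard ⟨hGH x, fun h => h2 (h h1)⟩ (Set.toFinite _)
    have := hH x
    omega
  have hnab : ¬ G.Adj a b := by rw [hG, SimpleGraph.deleteEdges_adj]; simp
  have ha := hlt a b hab hnab
  have hb := hlt b a hab.symm fun h => hnab h.symm
  have hcast : ((q - 1 : ℕ) : ℝ) = q - 1 := by rw [Nat.cast_sub hq, Nat.cast_one]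
  have hq' : (1 : ℝ) ≤ q := by exact_mod_cast hq
  induction l with
  | zero =>
    have h := wordSum_lostWalkInd_succ_le hG hH 0
    have h0 : wordSum 1 (lostWalkInd G H) = 0 := by simp [wordSum, lostWalkInd]
    have h1 : ∀ x : Fin n, wordSum 0 (fun w => walkInd G (x :: w)) = 1 := by
      simp [wordSum, walkInd]
    simp only [zero_add, h0, h1] at h
    simp only [zero_add, pow_zero, Nat.cast_zero]
    nlinarith
  | succ l ih =>
    have h := wordSum_lostWalkInd_succ_le hG hH (l + 1)
    have h1 := wordSum_walkInd_succ_le ha (by positivity) (wordSum_walkInd_le hGq l)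
    have h2 := wordSum_walkInd_succ_le hb (by positivity) (wordSum_walkInd_le hGq l)
    rw [hcast] at h1 h2
    push_cast
    rw [pow_succ]
    nlinarith [mul_le_mul_of_nonneg_left (h.trans (add_le_add_three ih h1 h2)) (by positivity : (0:ℝ) ≤ q)]

theorem FD_le_of_isEdgeDeletion {L : ℕ} (hq : 1 ≤ q) {G H : LabeledGraph n d q}
    (h : IsEdgeDeletion G H) : FD L G H ≤ editBound q L := by
  classical
  obtain ⟨⟨e, he, hg⟩, hl⟩ := h
  induction e using Sym2.ind with | _ a b => ?_
  refine (forestDist_le_sum _ _).trans ?_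
  have hE := lostWalkInd_nonneg G.graph H.graph
  refine (Finset.sum_le_sum (g := fun x : ForestVertex n L => lostWalkInd G.graph H.graph x.1)
    fun x _ => ?_).trans ((sum_forestVertex_le hE).trans ?_)
  · obtain ⟨w, h0, hw⟩ := x
    obtain ⟨u, w, rfl⟩ := List.exists_cons_of_ne_nil h0
    have himp : (u :: w).IsChain G.graph.Adj → (u :: w).IsChain H.graph.Adj := fun hc =>
      hc.imp fun x y hxy => by rw [hg] at hxy; exact (SimpleGraph.deleteEdges_adj.1 hxy).1
    simp only [forestAttr_cons, LabeledGraph.toAttr, lostWalkInd, hl]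
    by_cases h1 : (u :: w).IsChain G.graph.Adj
    · simp [h1, himp h1]
    · by_cases h2 : (u :: w).IsChain H.graph.Adj <;> simp [h1, h2]
  · rw [Finset.sum_range_succ', editBound, Finset.mul_sum]
    have h0 : wordSum (0 + 1) (lostWalkInd G.graph H.graph) = 0 := by simp [wordSum, lostWalkInd]
    rw [h0, add_zero]
    refine Finset.sum_le_sum fun l hl => ?_
    have hq' : (1 : ℝ) ≤ q := by exact_mod_cast hq
    have h1 := wordSum_lostWalkInd_le he hg hq H.degree_le l
    -- Bernoulli's inequality: `q + l * (q - 1) = 1 + (l + 1) * (q - 1)` is at most `q ^ (L + 1)`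
    -- for `l ≤ L`. This is the source of the factor `q ^ L` in `editBound`.
    have h2 : 1 + ((L + 1 : ℕ) : ℝ) * (q - 1) ≤ (1 + ((q : ℝ) - 1)) ^ (L + 1) :=
      one_add_mul_le_pow (by linarith) _
    have h3 : (l : ℝ) ≤ L := by exact_mod_cast (Finset.mem_range.1 hl).le
    rw [add_sub_cancel, pow_succ'] at h2
    push_cast at h2
    have h4 : (q : ℝ) + l * (q - 1) ≤ q * (q : ℝ) ^ L := by nlinarith
    have h5 : 2 * (q : ℝ) ^ l * (q + l * (q - 1)) ≤ 2 * (q : ℝ) ^ l * (q * (q : ℝ) ^ L) :=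
      mul_le_mul_of_nonneg_left h4 (by positivity)
    refine le_of_mul_le_mul_left ?_ (by linarith : (0 : ℝ) < q)
    linarith

end EdgeDeletion

/-! ### The edit graph on Weisfeiler–Leman classes. -/

section EditGraph

variable {n d q : ℕ}

theorem FD_comm (L : ℕ) (G H : LabeledGraph n d q) : FD L G H = FD L H G := forestDist_comm _ _

theorem FD_triangle (L : ℕ) (G H K : LabeledGraph n d q) : FD L G K ≤ FD L G H + FD L H K :=
  forestDist_triangle _ _ _

theorem FD_le_zero_of_wlClass_eq {L : ℕ} {G H : LabeledGraph n d q}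
    (h : wlClass L G = wlClass L H) : FD L G H ≤ 0 :=
  FD_le_zero_of_wlIndist (Quotient.exact h)

theorem editBound_nonneg (q L : ℕ) : 0 ≤ editBound q L := by unfold editBound; positivity

theorem two_le_editBound {q L : ℕ} (hq : 1 ≤ q) (hL : 1 ≤ L) : 2 ≤ editBound q L := by
  have hq' : (1 : ℝ) ≤ q := by exact_mod_cast hq
  obtain ⟨K, rfl⟩ : ∃ K, L = K + 1 := ⟨L - 1, by omega⟩
  have h1 : (1 : ℝ) ≤ (q : ℝ) ^ (K + 1) := one_le_pow₀ hq'
  have h2 : (1 : ℝ) ≤ ∑ i ∈ Finset.range (K + 1), (q : ℝ) ^ i := by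
    rw [Finset.sum_range_succ']
    have : 0 ≤ ∑ i ∈ Finset.range K, (q : ℝ) ^ (i + 1) := by positivity
    simpa using this
  unfold editBound
  nlinarith

theorem IsLabelChange.symm {G H : LabeledGraph n d q} (h : IsLabelChange G H) :
    IsLabelChange H G := by
  obtain ⟨hg, v, c, hl⟩ := h
  exact ⟨hg.symm, v, H.label v, by rw [hl]; simp⟩

/-- Two classes are adjacent if they are distinct and have representatives that differ by an edge
deletion, or are edgeless and differ by a label change. -/
def editGraph (n d q L : ℕ) : SimpleGraph (WLClass n d q L) :=
  SimpleGraph.fromRel fun a b => ∃ G H : LabeledGraph n d q, wlClass L G = a ∧ wlClass L H = b ∧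
    (IsEdgeDeletion G H ∨ (IsLabelChange G H ∧ G.graph = ⊥))

theorem reachable_editGraph_of_edit {L : ℕ} {G H : LabeledGraph n d q}
    (h : IsEdgeDeletion G H ∨ (IsLabelChange G H ∧ G.graph = ⊥)) :
    (editGraph n d q L).Reachable (wlClass L G) (wlClass L H) := by
  by_cases hc : wlClass L G = wlClass L H
  · rw [hc]
  · exact SimpleGraph.Adj.reachable ((SimpleGraph.fromRel_adj _ _ _).2
      ⟨hc, Or.inl ⟨G, H, rfl, rfl, h⟩⟩)

/-- The edgeless graph with given labels. -/
def edgelessGraph (q : ℕ) (c : Fin n → Fin d) : LabeledGraph n d q where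
  graph := ⊥
  label := c
  degree_le v := by simp [SimpleGraph.neighborSet]

/-- Induction on the number of edges; deleting an edge never violates the degree bound. -/
theorem reachable_editGraph_edgeless (L : ℕ) (G : LabeledGraph n d q) :
    (editGraph n d q L).Reachable (wlClass L (edgelessGraph q G.label)) (wlClass L G) := by
  induction hk : G.graph.edgeSet.ncard using Nat.strong_induction_on generalizing G with
  | _ k ih =>
    by_cases hG : G.graph = ⊥
    · have : edgelessGraph q G.label = G := LabeledGraph.ext hG.symm rfl
      rw [this]
    obtain ⟨e, he⟩ := SimpleGraph.edgeSet_nonempty.2 hG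
    let G' : LabeledGraph n d q := ⟨G.graph.deleteEdges {e}, G.label, fun v =>
      (Set.ncard_le_ncard (fun u hu => (SimpleGraph.deleteEdges_adj.1 hu).1)
        (Set.toFinite _)).trans (G.degree_le v)⟩
    have hlt : G'.graph.edgeSet.ncard < k := by
      rw [← hk]
      refine Set.ncard_lt_ncard ?_ (Set.toFinite _)
      rw [SimpleGraph.edgeSet_deleteEdges]
      exact ⟨Set.sdiff_subset, fun h => (h he).2 rfl⟩
    exact (ih _ hlt G' rfl).trans (reachable_editGraph_of_edit (Or.inl ⟨⟨e, he, rfl⟩, rfl⟩))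

theorem reachable_edgeless_edgeless (q L : ℕ) (c c' : Fin n → Fin d) :
    (editGraph n d q L).Reachable (wlClass L (edgelessGraph q c))
      (wlClass L (edgelessGraph q c')) := by
  classical
  have key : ∀ s : Finset (Fin n), (editGraph n d q L).Reachable
      (wlClass L (edgelessGraph q (s.piecewise c' c))) (wlClass L (edgelessGraph q c)) := by
    intro s
    induction s using Finset.induction_on with
    | empty => simp
    | insert v s _ ih =>
      refine SimpleGraph.Reachable.trans (reachable_editGraph_of_edit
        (H := edgelessGraph q (s.piecewise c' c)) (Or.inr ⟨⟨rfl, v, c' v, ?_⟩, rfl⟩)) ih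
      exact Finset.piecewise_insert _ _ _ _
  simpa using (key Finset.univ).symm

theorem editGraph_connected {d : ℕ} (hd : 1 ≤ d) (n q L : ℕ) : (editGraph n d q L).Connected := by
  have : Nonempty (WLClass n d q L) := ⟨wlClass L (edgelessGraph q fun _ => ⟨0, hd⟩)⟩
  refine SimpleGraph.Connected.mk fun a b => ?_
  induction a using Quotient.inductionOn with | _ G => ?_
  induction b using Quotient.inductionOn with | _ H => ?_
  exact (reachable_editGraph_edgeless L G).symm.trans
    ((reachable_edgeless_edgeless q L G.label H.label).trans (reachable_editGraph_edgeless L H))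

/-- No pair `(q, L)` is exceptional here: in an edgeless graph only the root carrying the changed
label matters, and `√2 ≤ 2 ≤ editBound q L`. -/
theorem FD_le_of_edit {L : ℕ} (hq : 1 ≤ q) (hL : 1 ≤ L) {G H : LabeledGraph n d q}
    (h : IsEdgeDeletion G H ∨ (IsLabelChange G H ∧ G.graph = ⊥)) : FD L G H ≤ editBound q L := by
  rcases h with h | ⟨h, hG⟩
  · exact FD_le_of_isEdgeDeletion hq h
  · have h1 := FD_le_of_isLabelChange (L := L) (r := 0) h (by simp [hG, SimpleGraph.neighborSet])
    rw [Finset.sum_range_succ'] at h1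
    have hs : Real.sqrt 2 ≤ 2 := Real.sqrt_le_iff.2 ⟨by norm_num, by norm_num⟩
    simp at h1
    exact h1.trans (hs.trans (two_le_editBound hq hL))

/-- Adjacency provides an edit only between some representatives; the distance bound reaches all of
them because classes have diameter zero. -/
theorem editGraph_adj {L : ℕ} (hq : 1 ≤ q) (hL : 1 ≤ L) {G H : LabeledGraph n d q}
    (h : (editGraph n d q L).Adj (wlClass L G) (wlClass L H)) : FD L G H ≤ editBound q L ∧
      ∃ G' H' : LabeledGraph n d q, wlClass L G' = wlClass L G ∧ wlClass L H' = wlClass L H ∧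
        (IsEdgeDeletion G' H' ∨ IsEdgeDeletion H' G' ∨ IsLabelChange G' H') := by
  have key : ∀ G H G' H' : LabeledGraph n d q, wlClass L G' = wlClass L G →
      wlClass L H' = wlClass L H → FD L G' H' ≤ editBound q L → FD L G H ≤ editBound q L := by
    intro G H G' H' hG hH h
    linarith [FD_triangle L G G' H, FD_triangle L G' H' H, FD_le_zero_of_wlClass_eq hG.symm,
      FD_le_zero_of_wlClass_eq hH]
  obtain ⟨-, ⟨G', H', hG, hH, h⟩ | ⟨H', G', hH, hG, h⟩⟩ := (SimpleGraph.fromRel_adj _ _ _).1 h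
  · exact ⟨key G H G' H' hG hH (FD_le_of_edit hq hL h), G', H', hG, hH,
      h.elim Or.inl fun h => Or.inr (Or.inr h.1)⟩
  · refine ⟨?_, G', H', hG, hH, h.elim (fun h => Or.inr (Or.inl h))
      fun h => Or.inr (Or.inr h.1.symm)⟩
    rw [FD_comm]
    exact key H G H' G' hH hG (FD_le_of_edit hq hL h)

end EditGraph

/-! ### Dominating sets in connected graphs and covering numbers. -/

section Covering

/-- A connected graph on at least `k + 1` vertices has a set of at most `m / (k + 1)` vertices
such that every vertex has distance at most `2 * k` to it. -/
theorem exists_dominating_finset {V : Type*} [Fintype V] {T : SimpleGraph V} (hT : T.Connected)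
    {k : ℕ} (hk : k + 1 ≤ Fintype.card V) :
    ∃ C : Finset V, C.card * (k + 1) ≤ Fintype.card V ∧ ∀ x, ∃ y ∈ C, T.dist x y ≤ 2 * k := by
  classical
  obtain ⟨r⟩ := hT.nonempty
  -- If all distances from `r` are below `k`, the root alone suffices. Otherwise each of the levels
  -- `0, …, k` is occupied, so every residue modulo `k + 1` occurs at a level at most `k`.
  by_cases hfar : ∃ z, k ≤ T.dist r z
  swap
  · push Not at hfar
    refine ⟨{r}, by simpa using hk, fun x => ⟨r, Finset.mem_singleton_self r, ?_⟩⟩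
    have := hfar x
    rw [SimpleGraph.dist_comm]
    omega
  obtain ⟨z, hz⟩ := hfar
  have anc : ∀ (x : V) (j : ℕ), j ≤ T.dist r x → ∃ y, T.dist r y = j ∧
      T.dist y x ≤ T.dist r x - j := by
    intro x j hj
    obtain ⟨p, hp⟩ := hT.exists_walk_length_eq_dist r x
    have h1 : T.dist r (p.getVert j) ≤ j :=
      (SimpleGraph.dist_le (p.take j)).trans (by simp)
    have h2 : T.dist (p.getVert j) x ≤ T.dist r x - j :=
      (SimpleGraph.dist_le (p.drop j)).trans (by simp [hp])
    have h3 : T.dist r x ≤ T.dist r (p.getVert j) + T.dist (p.getVert j) x := hT.dist_triangle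
    exact ⟨p.getVert j, by omega, h2⟩
  obtain ⟨i, hi, hcard⟩ := Finset.exists_min_image (Finset.range (k + 1))
    (fun i => (Finset.univ.filter fun x => T.dist r x % (k + 1) = i).card) ⟨0, by simp⟩
  have hik : i ≤ k := by simpa [Nat.lt_succ_iff] using hi
  refine ⟨Finset.univ.filter fun x => T.dist r x % (k + 1) = i, ?_, fun x => ?_⟩
  · have h1 : Fintype.card V = ∑ j ∈ Finset.range (k + 1),
        (Finset.univ.filter fun x => T.dist r x % (k + 1) = j).card :=
      Finset.card_eq_sum_card_fiberwise fun x _ => by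
        simpa using Nat.mod_lt _ (Nat.succ_pos k)
    rw [h1, mul_comm]
    simpa using Finset.card_nsmul_le_sum _ _ _ hcard
  · by_cases hx : i ≤ T.dist r x
    -- Climb towards the root to the nearest level congruent to `i`; this takes at most `k` steps.
    · obtain ⟨y, hy, hyx⟩ := anc x (T.dist r x - (T.dist r x - i) % (k + 1)) (by omega)
      have hmod : (T.dist r x - i) % (k + 1) < k + 1 := Nat.mod_lt _ (Nat.succ_pos k)
      have hdiv := Nat.div_add_mod (T.dist r x - i) (k + 1)
      have hle := Nat.mod_le (T.dist r x - i) (k + 1)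
      refine ⟨y, ?_, ?_⟩
      · rw [Finset.mem_filter]
        refine ⟨Finset.mem_univ _, ?_⟩
        have : T.dist r y = i + (k + 1) * ((T.dist r x - i) / (k + 1)) := by omega
        rw [this, Nat.add_mul_mod_self_left, Nat.mod_eq_of_lt (by omega)]
      · rw [SimpleGraph.dist_comm]
        omega
    -- Above level `i` there is no such ancestor. The detour through the root to a vertex at level
    -- `i` costs less than `i` plus `i`, which is why the radius is `2 * k`.
    · obtain ⟨y, hy, -⟩ := anc z i (by omega)
      refine ⟨y, ?_, ?_⟩
      · rw [Finset.mem_filter, hy, Nat.mod_eq_of_lt (by omega)]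
        exact ⟨Finset.mem_univ _, rfl⟩
      · have h3 : T.dist x y ≤ T.dist x r + T.dist r y := hT.dist_triangle
        rw [SimpleGraph.dist_comm (u := x) (v := r)] at h3
        omega

variable {n d q : ℕ}

theorem FD_le_of_walk {L : ℕ} (hq : 1 ≤ q) (hL : 1 ≤ L) {a b : WLClass n d q L}
    (p : (editGraph n d q L).Walk a b) (G H : LabeledGraph n d q) (hG : wlClass L G = a)
    (hH : wlClass L H = b) : FD L G H ≤ editBound q L * p.length := by
  induction p generalizing G with
  | nil => simpa using FD_le_zero_of_wlClass_eq (hG.trans hH.symm)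
  | @cons a c b h p ih =>
    obtain ⟨K, rfl⟩ := Quotient.exists_rep c
    subst hG
    have h1 := (editGraph_adj hq hL (H := K) h).1
    have h2 := ih K rfl hH
    rw [SimpleGraph.Walk.length_cons]
    push_cast
    linarith [FD_triangle L G K H]

/-- One graph is chosen from each dominating class. The argument needs only connectedness, so it
uses the whole edit graph and no spanning tree. -/
theorem exists_FD_cover (hd : 1 ≤ d) (hq : 1 ≤ q) {L k : ℕ} (hL : 1 ≤ L)
    (hk : k + 1 ≤ numWLClasses n d q L) :
    ∃ C : Finset (LabeledGraph n d q), C.card * (k + 1) ≤ numWLClasses n d q L ∧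
      ∀ G, ∃ H ∈ C, FD L G H ≤ 2 * editBound q L * k := by
  classical
  have : Fintype (WLClass n d q L) := Fintype.ofFinite _
  rw [numWLClasses, Nat.card_eq_fintype_card] at hk ⊢
  have hconn := editGraph_connected hd n q L
  obtain ⟨C, hC, hdom⟩ := exists_dominating_finset hconn hk
  refine ⟨C.image Quotient.out, (Nat.mul_le_mul_right _ Finset.card_image_le).trans hC,
    fun G => ?_⟩
  obtain ⟨y, hy, hdist⟩ := hdom (wlClass L G)
  refine ⟨y.out, Finset.mem_image_of_mem _ hy, ?_⟩
  obtain ⟨p, hp⟩ := hconn.exists_walk_length_eq_dist (wlClass L G) y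
  refine (FD_le_of_walk hq hL p G y.out rfl (Quotient.out_eq y)).trans ?_
  have h1 : (p.length : ℝ) ≤ 2 * k := by exact_mod_cast hp.trans_le hdist
  nlinarith [mul_le_mul_of_nonneg_left h1 (editBound_nonneg q L)]

/-- A minimal cover is at most as large as any other. -/
theorem coveringNumber_le {X : Type*} {dist : X → X → ℝ} {ε : ℝ} {C : Finset X}
    (hC : ∀ x, ∃ y ∈ C, dist x y ≤ ε) : coveringNumber dist ε ≤ C.card :=
  Nat.sInf_le ⟨C, rfl, hC⟩

end Covering

/-! ### Lipschitz continuity of message-passing networks. -/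

section Network

variable {L n d : ℕ}

theorem rowMul_zero {m p : ℕ} (W : Matrix (Fin m) (Fin p) ℝ) : rowMul W 0 = 0 := by
  simp [rowMul]

theorem rowMul_sub {m p : ℕ} (W : Matrix (Fin m) (Fin p) ℝ) (x y : EuclideanSpace ℝ (Fin m)) :
    rowMul W (x - y) = rowMul W x - rowMul W y := by
  simp [rowMul, Matrix.sub_vecMul]

open Classical in
/-- The network features of the vertices of the padded forest. -/
noncomputable def forestFeature (net : SumMPNN L d) (G : AttrGraph n d) (t : ℕ)
    (x : ForestVertex n L) : EuclideanSpace ℝ (Fin (featDim d net.width t)) :=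
  if x.1.IsChain G.graph.Adj then net.feature G t (x.1.head x.2.1) else 0

open Classical in
theorem forestFeature_cons (net : SumMPNN L d) (G : AttrGraph n d) (t : ℕ) (u : Fin n)
    (w : List (Fin n)) (h : u :: w ≠ [] ∧ (u :: w).length ≤ L + 1 ∧ (u :: w).IsChain (· ≠ ·)) :
    forestFeature net G t ⟨u :: w, h⟩ =
      if (u :: w).IsChain G.graph.Adj then net.feature G t u else 0 := rfl

theorem forestFeature_zero (net : SumMPNN L d) (G : AttrGraph n d) (x : ForestVertex n L) :
    forestFeature net G 0 x = forestAttr G L x := rfl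

-- Message passing can be carried out on the forest itself. Genuine children are the neighbors,
-- padding children contribute zero, and a padding vertex has only padding children, so `φ 0 = 0`
-- keeps it at zero. The length condition excludes the last level, where children are missing.
open Classical in
theorem forestFeature_succ {net : SumMPNN L d} {t : ℕ} (h0 : net.φ t 0 = 0) (G : AttrGraph n d)
    (x : ForestVertex n L) (hx : x.1.length ≤ L) :
    forestFeature net G (t + 1) x = net.φ t (rowMul (net.W₁ t) (forestFeature net G t x) +
      ∑ y ∈ Finset.univ.filter (fun y => IsChild x y),
        rowMul (net.W₂ t) (forestFeature net G t y)) := by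
  obtain ⟨w, hw0, hw⟩ := x
  obtain ⟨v, w, rfl⟩ := List.exists_cons_of_ne_nil hw0
  by_cases hg : (v :: w).IsChain G.graph.Adj
  · rw [forestFeature_cons, forestFeature_cons, if_pos hg, if_pos hg, SumMPNN.feature]
    congr 2
    have hmem : ∀ u, G.graph.Adj v u → (u :: v :: w).IsChain (· ≠ ·) := fun u hu =>
      List.isChain_cons_cons.2 ⟨hu.ne', hw.2⟩
    -- The value at non-neighbors is a dummy; the sum below only uses `e` on neighbors.
    let e : Fin n → ForestVertex n L := fun u =>
      if hu : G.graph.Adj v u then ⟨u :: v :: w, by simp, by simpa using hx, hmem u hu⟩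
      else ⟨v :: w, hw0, hw⟩
    have he : ∀ u (hu : G.graph.Adj v u),
        e u = ⟨u :: v :: w, by simp, by simpa using hx, hmem u hu⟩ := fun u hu => dif_pos hu
    refine Finset.sum_of_injOn e ?_ ?_ ?_ ?_
    · intro u hu u' hu' h
      simp only [Finset.coe_filter, Finset.mem_univ, true_and, Set.mem_ofPred_eq] at hu hu'
      rw [he u hu, he u' hu'] at h
      exact (List.cons.inj (congrArg Subtype.val h)).1
    · intro u hu
      simp only [Finset.coe_filter, Finset.mem_univ, true_and, Set.mem_ofPred_eq] at hu ⊢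
      rw [he u hu]
      exact ⟨u, rfl⟩
    · rintro ⟨y, hy⟩ hy1 hy2
      obtain ⟨u, hu⟩ := (Finset.mem_filter.1 hy1).2
      simp only at hu
      subst hu
      have hadj : ¬ G.graph.Adj v u := fun h =>
        hy2 ⟨u, by simpa using h, he u h⟩
      rw [forestFeature_cons, if_neg, rowMul_zero]
      intro hc
      exact hadj (List.isChain_cons_cons.1 hc).1.symm
    · intro u hu
      have hu : G.graph.Adj v u := by simpa using hu
      rw [he u hu, forestFeature_cons, if_pos (List.isChain_cons_cons.2 ⟨hu.symm, hg⟩)]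
  · rw [forestFeature_cons, forestFeature_cons, if_neg hg, if_neg hg, rowMul_zero, zero_add,
      Finset.sum_eq_zero, h0]
    rintro ⟨y, hy⟩ hy1
    obtain ⟨u, hu⟩ := (Finset.mem_filter.1 hy1).2
    simp only at hu
    subst hu
    rw [forestFeature_cons, if_neg, rowMul_zero]
    exact fun hc => hg hc.tail

open Classical in
/-- Every vertex of the forest has at most one parent. -/
theorem sum_sum_isChild_le (s : Finset (ForestVertex n L)) (p : ForestVertex n L → Prop) [DecidablePred p]
    (hp : ∀ x ∈ s, ∀ y, IsChild x y → p y) {g : ForestVertex n L → ℝ} (hg : ∀ x, 0 ≤ g x) :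
    ∑ x ∈ s, ∑ y ∈ Finset.univ.filter (fun y => IsChild x y), g y ≤
      ∑ y ∈ Finset.univ.filter p, g y := by
  rw [← Finset.sum_biUnion]
  · refine Finset.sum_le_sum_of_subset_of_nonneg ?_ fun y _ _ => hg y
    intro y hy
    obtain ⟨x, hx, hy⟩ := Finset.mem_biUnion.1 hy
    simpa using hp x hx y (by simpa using hy)
  · intro x _ x' _ hne
    refine Finset.disjoint_left.2 fun y hy hy' => hne ?_
    obtain ⟨v, hv⟩ := (Finset.mem_filter.1 hy).2
    obtain ⟨v', hv'⟩ := (Finset.mem_filter.1 hy').2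
    exact Subtype.ext (List.cons.inj (hv.symm.trans hv')).2

open Classical in
/-- One layer multiplies the summed feature differences by at most `2 * B * Lφ t`. -/
theorem sum_norm_forestFeature_sub_succ_le {net : SumMPNN L d} {Lφ : ℕ → ℝ≥0} {Lψ B : ℝ≥0}
    (hnet : net.Admissible Lφ Lψ B) (G H : AttrGraph n d) (φ : ForestIso n L) {t : ℕ} (ht : t < L) :
    ∑ x ∈ Finset.univ.filter (fun x : ForestVertex n L => x.1.length + (t + 1) ≤ L + 1),
      ‖forestFeature net G (t + 1) x - forestFeature net H (t + 1) (φ.1 x)‖ ≤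
    2 * B * Lφ t * ∑ x ∈ Finset.univ.filter (fun x : ForestVertex n L => x.1.length + t ≤ L + 1),
      ‖forestFeature net G t x - forestFeature net H t (φ.1 x)‖ := by
  set D : ForestVertex n L → ℝ := fun x =>
    ‖forestFeature net G t x - forestFeature net H t (φ.1 x)‖
  have hD0 : ∀ x, 0 ≤ D x := fun x => norm_nonneg _
  have h1 : ∀ x : ForestVertex n L, x.1.length + (t + 1) ≤ L + 1 →
      ‖forestFeature net G (t + 1) x - forestFeature net H (t + 1) (φ.1 x)‖ ≤
        Lφ t * (B * D x + B * ∑ y ∈ Finset.univ.filter (fun y => IsChild x y), D y) := by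
    intro x hx
    rw [forestFeature_succ (hnet.φ_zero t ht) G x (by omega),
      forestFeature_succ (hnet.φ_zero t ht) H (φ.1 x) (by rw [φ.length_eq]; omega)]
    -- An isomorphism maps the children of `x` onto those of its image, so the two aggregations can
    -- be compared term by term.
    have hsum : ∑ y ∈ Finset.univ.filter (fun y => IsChild (φ.1 x) y),
        rowMul (net.W₂ t) (forestFeature net H t y) =
        ∑ y ∈ Finset.univ.filter (fun y => IsChild x y),
          rowMul (net.W₂ t) (forestFeature net H t (φ.1 y)) := by
      refine (Finset.sum_equiv φ.1 (fun y => ?_) fun y _ => rfl).symm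
      simpa using φ.2 x y
    rw [hsum, ← dist_eq_norm]
    refine ((hnet.lipschitz_φ t ht).dist_le_mul _ _).trans
      (mul_le_mul_of_nonneg_left ?_ (Lφ t).coe_nonneg)
    rw [dist_eq_norm, add_sub_add_comm, ← rowMul_sub, ← Finset.sum_sub_distrib]
    refine (norm_add_le _ _).trans (add_le_add (hnet.norm_W₁ t ht _) ?_)
    rw [Finset.mul_sum]
    refine (norm_sum_le _ _).trans (Finset.sum_le_sum fun y _ => ?_)
    rw [← rowMul_sub]
    exact hnet.norm_W₂ t ht _
  refine (Finset.sum_le_sum fun x hx => h1 x (by simpa using hx)).trans ?_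
  rw [← Finset.mul_sum, Finset.sum_add_distrib, ← Finset.mul_sum, ← Finset.mul_sum]
  -- Both the own terms and the child terms are bounded by the sum over one more level, since no
  -- vertex is a child twice; hence the factor 2.
  have h2 := sum_sum_isChild_le
    (Finset.univ.filter (fun x : ForestVertex n L => x.1.length + (t + 1) ≤ L + 1))
    (fun x => x.1.length + t ≤ L + 1) (by
      rintro x hx y ⟨v, hv⟩
      have hx : x.1.length + (t + 1) ≤ L + 1 := by simpa using hx
      rw [hv, List.length_cons]
      omega) hD0
  have h3 : ∑ x ∈ Finset.univ.filter (fun x : ForestVertex n L => x.1.length + (t + 1) ≤ L + 1),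
      D x ≤ ∑ x ∈ Finset.univ.filter (fun x : ForestVertex n L => x.1.length + t ≤ L + 1), D x := by
    refine Finset.sum_le_sum_of_subset_of_nonneg ?_ fun y _ _ => hD0 y
    intro x hx
    simp only [Finset.mem_filter, Finset.mem_univ, true_and] at hx ⊢
    omega
  have h4 : ∀ a b c : ℝ, a ≤ c → b ≤ c → Lφ t * (B * a + B * b) ≤ 2 * B * Lφ t * c := by
    intro a b c ha hb
    calc (Lφ t : ℝ) * (B * a + B * b) ≤ Lφ t * (B * c + B * c) := by gcongr
      _ = 2 * B * Lφ t * c := by ring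
  exact h4 _ _ _ h3 h2

-- The recursion is unavailable at the last level, so each layer costs one level: after `t` layers
-- the sum covers levels up to `L - t`, and for `t = L` only the roots.
open Classical in
theorem sum_norm_forestFeature_sub_le {net : SumMPNN L d} {Lφ : ℕ → ℝ≥0} {Lψ B : ℝ≥0}
    (hnet : net.Admissible Lφ Lψ B) (G H : AttrGraph n d) (φ : ForestIso n L) {t : ℕ} (ht : t ≤ L) :
    ∑ x ∈ Finset.univ.filter (fun x : ForestVertex n L => x.1.length + t ≤ L + 1),
      ‖forestFeature net G t x - forestFeature net H t (φ.1 x)‖ ≤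
    (2 * B) ^ t * (∏ s ∈ Finset.range t, (Lφ s : ℝ)) *
      ∑ x : ForestVertex n L, ‖forestAttr G L x - forestAttr H L (φ.1 x)‖ := by
  induction t with
  | zero =>
    simp only [pow_zero, Finset.range_zero, Finset.prod_empty, one_mul, forestFeature_zero]
    exact Finset.sum_le_sum_of_subset_of_nonneg (Finset.filter_subset _ _)
      fun _ _ _ => norm_nonneg _
  | succ t ih =>
    refine (sum_norm_forestFeature_sub_succ_le hnet G H φ ht).trans ?_
    refine (mul_le_mul_of_nonneg_left (ih (by omega)) (by positivity)).trans (le_of_eq ?_)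
    rw [Finset.prod_range_succ, pow_succ]
    ring

open Classical in
theorem sum_feature_eq (net : SumMPNN L d) (G : AttrGraph n d) :
    ∑ u, net.feature G L u =
      ∑ x ∈ Finset.univ.filter (fun x : ForestVertex n L => x.1.length + L ≤ L + 1),
        forestFeature net G L x := by
  refine Finset.sum_bij (fun u _ => ⟨[u], by simp⟩) ?_ ?_ ?_ ?_
  · intro u _
    exact Finset.mem_filter.2 ⟨Finset.mem_univ _, by simp [add_comm]⟩
  · intro u _ u' _ h
    simpa using congrArg Subtype.val h
  · rintro ⟨w, hw0, hw⟩ hx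
    obtain ⟨v, w, rfl⟩ := List.exists_cons_of_ne_nil hw0
    have hl : (v :: w).length + L ≤ L + 1 := (Finset.mem_filter.1 hx).2
    have : w = [] := List.length_eq_zero_iff.1 (by rw [List.length_cons] at hl; omega)
    subst this
    exact ⟨v, Finset.mem_univ v, rfl⟩
  · intro u _
    rw [forestFeature_cons, if_pos (by simp)]

/-- Message-passing networks are Lipschitz with respect to the Forest distance. -/
theorem norm_embed_sub_le {net : SumMPNN L d} {Lφ : ℕ → ℝ≥0} {Lψ B : ℝ≥0}
    (hnet : net.Admissible Lφ Lψ B) (G H : AttrGraph n d) :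
    ‖net.embed G - net.embed H‖ ≤
      1 / (n : ℝ) * ((2 * B) ^ L * Lψ * ∏ t ∈ Finset.range L, (Lφ t : ℝ)) * forestDist L G H := by
  classical
  obtain ⟨φ, hφ⟩ := exists_forestDist_eq (L := L) G H
  have h1 : ‖(∑ u, net.feature G L u) - ∑ u, net.feature H L u‖ ≤
      (2 * B) ^ L * (∏ s ∈ Finset.range L, (Lφ s : ℝ)) * forestDist L G H := by
    have hsum : ∑ x ∈ Finset.univ.filter (fun x : ForestVertex n L => x.1.length + L ≤ L + 1),
        forestFeature net H L x =
        ∑ x ∈ Finset.univ.filter (fun x : ForestVertex n L => x.1.length + L ≤ L + 1),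
          forestFeature net H L (φ.1 x) := by
      refine (Finset.sum_equiv φ.1 (fun y => ?_) fun y _ => rfl).symm
      simp [φ.length_eq]
    rw [sum_feature_eq, sum_feature_eq, hsum, ← Finset.sum_sub_distrib, ← hφ]
    exact (norm_sum_le _ _).trans (sum_norm_forestFeature_sub_le hnet G H φ le_rfl)
  rw [← dist_eq_norm]
  refine (hnet.lipschitz_ψ.dist_le_mul _ _).trans ?_
  rw [dist_eq_norm, ← smul_sub, norm_smul, Real.norm_of_nonneg (by positivity)]
  refine (mul_le_mul_of_nonneg_left (mul_le_mul_of_nonneg_left h1 (by positivity))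
    Lψ.coe_nonneg).trans (le_of_eq ?_)
  ring

end Network

/-! ### Concentration of cell frequencies. -/

section Concentration

variable {Z : Type*} [MeasurableSpace Z] (μ : Measure Z) [IsProbabilityMeasure μ]

/-- Hoeffding's inequality for the frequency of an event in an i.i.d. sample. -/
theorem measure_frequency_ge_le {A : Set Z} (hA : MeasurableSet A) {N : ℕ} {ε : ℝ} (hε : 0 ≤ ε) :
    (Measure.pi (fun _ : Fin N => μ)).real
      {S | ε ≤ ∑ i, (A.indicator (fun _ => (1 : ℝ)) (S i) - μ.real A)} ≤
        Real.exp (-ε ^ 2 / (2 * (N * (1 / 4)))) := by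
  let X : Z → ℝ := fun z => A.indicator (fun _ => (1 : ℝ)) z - μ.real A
  have hm : Measurable (A.indicator (fun _ => (1 : ℝ))) := measurable_const.indicator hA
  have hX : Measurable X := hm.sub_const _
  -- The variance proxy `1 / 4` is the squared half-length of `[0, 1]`.
  have h1 : ProbabilityTheory.HasSubgaussianMGF X (1 / 4) μ := by
    have h := ProbabilityTheory.hasSubgaussianMGF_of_mem_Icc (μ := μ) (a := 0) (b := 1)
      (X := A.indicator (fun _ => (1 : ℝ))) hm.aemeasurable (Filter.Eventually.of_forall fun z => by
        by_cases hz : z ∈ A <;> simp [hz])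
    rw [integral_indicator_const _ hA, smul_eq_mul, mul_one] at h
    convert h using 1
    norm_num
  have hind : ProbabilityTheory.iIndepFun (fun (i : Fin N) (S : Fin N → Z) => X (S i))
      (Measure.pi fun _ => μ) :=
    ProbabilityTheory.iIndepFun_pi (X := fun _ => X) fun _ => hX.aemeasurable
  have hsub : ∀ i ∈ (Finset.univ : Finset (Fin N)), ProbabilityTheory.HasSubgaussianMGF
      (fun S : Fin N → Z => X (S i)) (1 / 4) (Measure.pi fun _ => μ) := by
    intro i _
    have hmp := measurePreserving_eval (fun _ : Fin N => μ) i
    refine ProbabilityTheory.HasSubgaussianMGF.of_map (X := X) (Y := fun S : Fin N → Z => S i)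
      (measurable_pi_apply i).aemeasurable ?_
    have := hmp.map_eq
    rwa [show (Measure.map (fun S : Fin N → Z => S i) (Measure.pi fun _ => μ)) = μ from this]
  have h := ProbabilityTheory.HasSubgaussianMGF.measure_sum_ge_le_of_iIndepFun hind (c := fun _ => 1 / 4) hsub hε
  simpa [X] using h

/-- The Bretagnolle--Huber--Carol inequality: the sum of the absolute deviations of the cell
frequencies of an i.i.d. sample, for a partition into finitely many cells. -/
theorem measure_sum_abs_frequency_ge_le {κ : Type*} [Fintype κ] [MeasurableSpace κ]
    [DiscreteMeasurableSpace κ] {c : Z → κ} (hc : Measurable c) {N : ℕ} {ε : ℝ} (hε : 0 ≤ ε) :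
    (Measure.pi (fun _ : Fin N => μ)).real
      {S | 2 * ε ≤ ∑ j, |∑ i, ((c ⁻¹' {j}).indicator (fun _ => (1 : ℝ)) (S i) -
        μ.real (c ⁻¹' {j}))|} ≤
        2 ^ Fintype.card κ * Real.exp (-ε ^ 2 / (2 * (N * (1 / 4)))) := by
  classical
  let D : κ → (Fin N → Z) → ℝ := fun j S =>
    ∑ i, ((c ⁻¹' {j}).indicator (fun _ => (1 : ℝ)) (S i) - μ.real (c ⁻¹' {j}))
  have hD : ∀ (s : Finset κ) (S : Fin N → Z), ∑ j ∈ s, D j S =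
      ∑ i, ((c ⁻¹' s).indicator (fun _ => (1 : ℝ)) (S i) - μ.real (c ⁻¹' s)) := by
    intro s S
    simp only [D]
    rw [Finset.sum_comm]
    refine Finset.sum_congr rfl fun i _ => ?_
    rw [Finset.sum_sub_distrib]
    congr 1
    · by_cases h : c (S i) ∈ s <;> simp [Set.indicator_apply, h]
    · rw [← measureReal_biUnion_finset]
      · congr 1
        ext z
        simp
      · intro j _ j' _ hne
        exact Disjoint.preimage c (by simpa using hne)
      · exact fun j _ => hc (MeasurableSet.of_discrete)
  -- The deviations sum to zero, so the nonnegative ones make up half of the absolute sum. Their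
  -- cells form one of `2 ^ card κ` subsets, to which the union bound and Hoeffding's inequality
  -- apply.
  have hsub : {S | 2 * ε ≤ ∑ j, |D j S|} ⊆ ⋃ s ∈ (Finset.univ : Finset (Finset κ)),
      {S | ε ≤ ∑ i, ((c ⁻¹' s).indicator (fun _ => (1 : ℝ)) (S i) - μ.real (c ⁻¹' s))} := by
    intro S hS
    have hS : 2 * ε ≤ ∑ j, |D j S| := hS
    simp only [Finset.mem_univ, Set.iUnion_true, Set.mem_iUnion, Set.mem_ofPred_eq]
    refine ⟨Finset.univ.filter fun j => 0 ≤ D j S, ?_⟩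
    have htot : ∑ j, D j S = 0 := by
      rw [hD]
      simp
    rw [← hD]
    have h1 := Finset.sum_filter_add_sum_filter_not Finset.univ (fun j => 0 ≤ D j S) (D · S)
    have h2 := Finset.sum_filter_add_sum_filter_not Finset.univ (fun j => 0 ≤ D j S) (|D · S|)
    have h3 : ∑ j ∈ Finset.univ.filter (fun j => 0 ≤ D j S), |D j S| =
        ∑ j ∈ Finset.univ.filter (fun j => 0 ≤ D j S), D j S :=
      Finset.sum_congr rfl fun j hj => abs_of_nonneg (Finset.mem_filter.1 hj).2
    have h4 : ∑ j ∈ Finset.univ.filter (fun j => ¬ 0 ≤ D j S), |D j S| =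
        - ∑ j ∈ Finset.univ.filter (fun j => ¬ 0 ≤ D j S), D j S := by
      rw [← Finset.sum_neg_distrib]
      exact Finset.sum_congr rfl fun j hj => abs_of_neg (not_le.1 (Finset.mem_filter.1 hj).2)
    linarith
  refine (measureReal_mono hsub (measure_ne_top _ _)).trans
    ((measureReal_biUnion_finset_le _ _).trans ?_)
  refine (Finset.sum_le_sum fun (s : Finset κ) _ => measure_frequency_ge_le μ
    (A := c ⁻¹' (s : Set κ)) (hc MeasurableSet.of_discrete) hε).trans (le_of_eq ?_)
  rw [Finset.sum_const, Finset.card_univ, Fintype.card_finset, nsmul_eq_mul]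
  push_cast
  rfl

end Concentration

/-! ### Generalization from robustness. -/

section Robustness

variable {Z : Type*} [MeasurableSpace Z] (μ : Measure Z) [IsProbabilityMeasure μ]

/-- If a function is within `η` of its value at the representative of the cell, its mean and its
sample mean differ by at most `2 * η` and the deviations of the cell frequencies. -/
theorem abs_integral_sub_mean_le [DiscreteMeasurableSpace Z] [Finite Z] {κ : Type*} [Fintype κ]
    {c : Z → κ} {f : Z → ℝ} {v : κ → ℝ} {η M : ℝ} (hv : ∀ j, |v j| ≤ M)
    (hf : ∀ z, |f z - v (c z)| ≤ η) {N : ℕ} (hN : 1 ≤ N) (S : Fin N → Z) :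
    |∫ z, f z ∂μ - 1 / (N : ℝ) * ∑ i, f (S i)| ≤ 2 * η + M * (1 / (N : ℝ) *
      ∑ j, |∑ i, ((c ⁻¹' {j}).indicator (fun _ => (1 : ℝ)) (S i) - μ.real (c ⁻¹' {j}))|) := by
  classical
  have hN' : (N : ℝ) ≠ 0 := by positivity
  have hvc : ∀ z, v (c z) = ∑ j, v j * (c ⁻¹' {j}).indicator (fun _ => (1 : ℝ)) z := by
    intro z
    simp [Set.indicator_apply]
  -- Replacing `f` by its cell values costs `η` in the mean and `η` in the sample mean; what remains
  -- is linear in the cell frequencies.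
  have h1 : |∫ z, f z ∂μ - ∫ z, v (c z) ∂μ| ≤ η := by
    rw [← integral_sub .of_finite .of_finite]
    simpa using norm_integral_le_of_norm_le_const (μ := μ) 
      (f := fun z => f z - v (c z)) (Filter.Eventually.of_forall hf)
  have h2 : |1 / (N : ℝ) * ∑ i, f (S i) - 1 / (N : ℝ) * ∑ i, v (c (S i))| ≤ η := by
    rw [← mul_sub, ← Finset.sum_sub_distrib, abs_mul, abs_of_nonneg (by positivity)]
    have : |∑ i, (f (S i) - v (c (S i)))| ≤ N * η :=
      (Finset.abs_sum_le_sum_abs _ _).trans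
        ((Finset.sum_le_sum fun i _ => hf (S i)).trans (by simp))
    calc 1 / (N : ℝ) * |∑ i, (f (S i) - v (c (S i)))| ≤ 1 / (N : ℝ) * (N * η) := by gcongr
      _ = η := by field_simp
  have h3 : ∫ z, v (c z) ∂μ = ∑ j, v j * μ.real (c ⁻¹' {j}) := by
    simp only [hvc]
    rw [integral_finsetSum _ fun _ _ => .of_finite]
    refine Finset.sum_congr rfl fun j _ => ?_
    rw [integral_const_mul, integral_indicator_const _ .of_discrete, smul_eq_mul, mul_one]
  have h4 : 1 / (N : ℝ) * ∑ i, v (c (S i)) - ∫ z, v (c z) ∂μ = 1 / (N : ℝ) * ∑ j, v j *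
      ∑ i, ((c ⁻¹' {j}).indicator (fun _ => (1 : ℝ)) (S i) - μ.real (c ⁻¹' {j})) := by
    rw [h3]
    simp only [hvc, Finset.sum_sub_distrib, mul_sub, Finset.sum_const, Finset.card_univ,
      Fintype.card_fin, nsmul_eq_mul]
    rw [Finset.sum_comm]
    congr 1
    · simp only [Finset.mul_sum]
    · rw [Finset.mul_sum]
      refine Finset.sum_congr rfl fun j _ => ?_
      field_simp
  have h5 : |1 / (N : ℝ) * ∑ i, v (c (S i)) - ∫ z, v (c z) ∂μ| ≤ M * (1 / (N : ℝ) *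
      ∑ j, |∑ i, ((c ⁻¹' {j}).indicator (fun _ => (1 : ℝ)) (S i) - μ.real (c ⁻¹' {j}))|) := by
    rw [h4, abs_mul, abs_of_nonneg (by positivity : (0 : ℝ) ≤ 1 / N), mul_left_comm M,
      Finset.mul_sum]
    refine mul_le_mul_of_nonneg_left ?_ (by positivity)
    refine (Finset.abs_sum_le_sum_abs _ _).trans (Finset.sum_le_sum fun j _ => ?_)
    rw [abs_mul]
    exact mul_le_mul_of_nonneg_right (hv j) (abs_nonneg _)
  rw [abs_le] at *
  constructor <;> linarith [h1.1, h1.2, h2.1, h2.2, h5.1, h5.2]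

/-- The Xu--Mannor generalization bound for robust learning algorithms. -/
theorem robust_generalization [DiscreteMeasurableSpace Z] [Finite Z] {κ : Type*} [Fintype κ]
    {c : Z → κ} {N : ℕ} (hN : 1 ≤ N) {f : (Fin N → Z) → Z → ℝ} {v : (Fin N → Z) → κ → ℝ} {η M : ℝ}
    (hM : 0 ≤ M) (hv : ∀ S j, |v S j| ≤ M) (hf : ∀ S z, |f S z - v S (c z)| ≤ η)
    {δ : ℝ} (h0 : 0 < δ) (h1 : δ < 1) :
    1 - δ ≤ (Measure.pi (fun _ : Fin N => μ)).real
      {S | |∫ z, f S z ∂μ - 1 / (N : ℝ) * ∑ i, f S (S i)| ≤ 2 * η + M * Real.sqrt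
        ((2 * Fintype.card κ * Real.log 2 + 2 * Real.log (1 / δ)) / (N : ℝ))} := by
  have hN' : (0 : ℝ) < N := by exact_mod_cast hN
  set lam : ℝ := Real.sqrt
    ((2 * Fintype.card κ * Real.log 2 + 2 * Real.log (1 / δ)) / (N : ℝ)) with hlam
  have hlog : 0 ≤ Real.log (1 / δ) := Real.log_nonneg (by rw [le_div_iff₀ h0]; linarith)
  have hlog2 : 0 ≤ Real.log 2 := Real.log_nonneg (by norm_num)
  have hsq : lam ^ 2 = (2 * Fintype.card κ * Real.log 2 + 2 * Real.log (1 / δ)) / (N : ℝ) :=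
    Real.sq_sqrt (by positivity)
  have hlam0 : 0 ≤ lam := Real.sqrt_nonneg _
  let _ : MeasurableSpace κ := ⊤
  -- This `ε` makes the exponent `-N * lam ^ 2 / 2`, which cancels `2 ^ card κ` and leaves exactly
  -- `δ`.
  have hbad := measure_sum_abs_frequency_ge_le μ (c := c) .of_discrete (N := N)
    (ε := N * lam / 2) (by positivity)
  have hexp : (2 : ℝ) ^ Fintype.card κ * Real.exp (-(N * lam / 2) ^ 2 / (2 * (N * (1 / 4)))) =
      δ := by
    have : -(N * lam / 2) ^ 2 / (2 * (N * (1 / 4))) =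
        Real.log δ - Fintype.card κ * Real.log 2 := by
      have h2 : -(N * lam / 2) ^ 2 / (2 * (N * (1 / 4))) = - (N * lam ^ 2 / 2) := by
        field_simp
        ring
      rw [h2, hsq, one_div, Real.log_inv]
      field_simp
      ring
    rw [this, Real.exp_sub, Real.exp_log h0, Real.exp_nat_mul, Real.exp_log (by norm_num)]
    field_simp
  rw [hexp] at hbad
  have hmeas : MeasurableSet {S : Fin N → Z | 2 * (N * lam / 2) ≤ ∑ j,
      |∑ i, ((c ⁻¹' {j}).indicator (fun _ => (1 : ℝ)) (S i) - μ.real (c ⁻¹' {j}))|} :=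
    .of_discrete
  have hcompl := probReal_compl_eq_one_sub (μ := Measure.pi (fun _ : Fin N => μ)) hmeas
  refine (by linarith : 1 - δ ≤ _).trans (hcompl.symm.le.trans
    (measureReal_mono ?_ (measure_ne_top _ _)))
  intro S hS
  have hS : ¬ 2 * (N * lam / 2) ≤ ∑ j,
      |∑ i, ((c ⁻¹' {j}).indicator (fun _ => (1 : ℝ)) (S i) - μ.real (c ⁻¹' {j}))| := hS
  refine (abs_integral_sub_mean_le μ (hv S) (hf S) hN S).trans ?_
  refine add_le_add le_rfl (mul_le_mul_of_nonneg_left ?_ hM)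
  rw [one_div, inv_mul_le_iff₀ hN']
  linarith

end Robustness

instance (n d q : ℕ) : DiscreteMeasurableSpace (LabeledGraph n d q) := ⟨fun _ => trivial⟩

theorem abs_bce_sub_le {L n d q : ℕ} {M' : ℝ} {Lloss Lfnn Lψ B : ℝ≥0} {Lφ : ℕ → ℝ≥0}
    (hloss : ∀ y : Bool, LipschitzWith Lloss (fun x => bce x y)) {h : LabeledGraph n d q → ℝ}
    (hh : h ∈ MPNNSum L M' Lfnn Lφ Lψ B n d q) (G H : LabeledGraph n d q) (y : Bool) :
    |bce (h G) y - bce (h H) y| ≤ Lloss * (Lfnn * (1 / (n : ℝ) *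
      ((2 * B) ^ L * Lψ * ∏ t ∈ Finset.range L, (Lφ t : ℝ)) * FD L G H)) := by
  obtain ⟨net, hnet, f, hf, hG⟩ := hh
  refine ((hloss y).dist_le_mul _ _).trans (mul_le_mul_of_nonneg_left ?_ Lloss.coe_nonneg)
  rw [(hG G).1, (hG H).1]
  refine (hf.dist_le_mul _ _).trans (mul_le_mul_of_nonneg_left ?_ Lfnn.coe_nonneg)
  rw [dist_eq_norm]
  exact norm_embed_sub_le hnet _ _

/-- A cell consists of the examples with a given cover element and label, and its value is the loss
at that cover element. The label doubles the number of cells, which turns `2 * log 2` into `4 * log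
2`; the cover radius `2 * editBound q L * k` enters `η`. -/
theorem generalization_bound {L n d q : ℕ} (hL : 1 ≤ L) (hd : 1 ≤ d) (hq : 1 ≤ q) {M' M : ℝ}
    {Lloss Lfnn Lψ B : ℝ≥0} {Lφ : ℕ → ℝ≥0}
    (hloss : ∀ y : Bool, LipschitzWith Lloss (fun x => bce x y))
    (hM : ∀ h ∈ MPNNSum L M' Lfnn Lφ Lψ B n d q, ∀ (G : LabeledGraph n d q) (y : Bool),
      |bce (h G) y| ≤ M)
    (μ : Measure (LabeledGraph n d q × Bool)) [IsProbabilityMeasure μ] {N : ℕ} (hN : 1 ≤ N)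
    {A : (Fin N → LabeledGraph n d q × Bool) → LabeledGraph n d q → ℝ}
    (hA : ∀ S, A S ∈ MPNNSum L M' Lfnn Lφ Lψ B n d q) {δ : ℝ} (h0 : 0 < δ) (h1 : δ < 1) {k : ℕ}
    (hk : k + 1 ≤ numWLClasses n d q L) :
    1 - δ ≤ (Measure.pi (fun _ : Fin N => μ)).real
      {S | |expLoss μ (A S) - empLoss S (A S)| ≤
        2 * (2 / (n : ℝ) * Lloss * Lfnn *
            ((2 * B) ^ L * Lψ * ∏ t ∈ Finset.range L, (Lφ t : ℝ))) * editBound q L * k +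
          M * Real.sqrt
            (((numWLClasses n d q L : ℝ) / ((k : ℝ) + 1) * (4 * Real.log 2) +
              2 * Real.log (1 / δ)) / (N : ℝ))} := by
  obtain ⟨C, hC, hcover⟩ := exists_FD_cover (n := n) hd hq hL hk
  choose r hrC hr using hcover
  -- The hypothesis class contains the output of the algorithm and there is at least one graph, so
  -- `M` bounds some absolute value.
  have hM0 : 0 ≤ M := by
    let G : LabeledGraph n d q := edgelessGraph q fun _ => ⟨0, hd⟩
    exact (abs_nonneg _).trans (hM _ (hA fun _ => (G, true)) G true)
  let c : LabeledGraph n d q × Bool → C × Bool := fun z => (⟨r z.1, hrC z.1⟩, z.2)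
  let K : ℝ := (2 * B) ^ L * Lψ * ∏ t ∈ Finset.range L, (Lφ t : ℝ)
  have hK : 0 ≤ K := by positivity
  have hgen := robust_generalization μ hN (c := c) (f := fun S z => bce (A S z.1) z.2)
    (v := fun S j => bce (A S j.1) j.2)
    (η := Lloss * (Lfnn * (1 / (n : ℝ) * K * (2 * editBound q L * k)))) hM0
    (fun S j => hM _ (hA S) _ _) (fun S z => (abs_bce_sub_le hloss (hA S) _ _ _).trans
      (by have := hr z.1; gcongr)) h0 h1
  refine hgen.trans (measureReal_mono (fun S hS => ?_) (measure_ne_top _ _))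
  refine le_trans (show |expLoss μ (A S) - empLoss S (A S)| ≤ _ from hS) (add_le_add
    (le_of_eq (by ring)) (mul_le_mul_of_nonneg_left (Real.sqrt_le_sqrt ?_) hM0))
  have hcard : (Fintype.card (C × Bool) : ℝ) ≤
      2 * ((numWLClasses n d q L : ℝ) / ((k : ℝ) + 1)) := by
    rw [Fintype.card_prod, Fintype.card_coe, Fintype.card_bool]
    push_cast
    have : (C.card : ℝ) ≤ (numWLClasses n d q L : ℝ) / ((k : ℝ) + 1) := by
      rw [le_div_iff₀ (by positivity)]
      exact_mod_cast hC
    linarith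
  have hlog2 : 0 ≤ Real.log 2 := Real.log_nonneg (by norm_num)
  have hmul := mul_le_mul_of_nonneg_right hcard hlog2
  exact div_le_div_of_nonneg_right (by linarith) (Nat.cast_nonneg N)

end ForestGen

/-! ### Assembly of the main theorem. -/

open ForestGen in
theorem mainTheorem8 (L : ℕ) (hL : 1 ≤ L) :
    -- combinatorial part
    (∀ n d q : ℕ, 1 ≤ n → 1 ≤ d → 1 ≤ q →
      (∀ G H : LabeledGraph n d q, IsEdgeDeletion G H → FD L G H ≤ editBound q L) ∧
      (∀ G H : LabeledGraph n d q, IsLabelChange G H →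
        FD L G H ≤ Real.sqrt 2 * ∑ l ∈ Finset.range (L + 1), (q : ℝ) ^ l ∧
        ((q, L) ≠ (1, 1) → (q, L) ≠ (1, 2) → (q, L) ≠ (2, 1) → FD L G H ≤ editBound q L)) ∧
      (∃ T : SimpleGraph (WLClass n d q L), T.IsTree ∧
        (∀ G H : LabeledGraph n d q, T.Adj (wlClass L G) (wlClass L H) →
          FD L G H ≤ editBound q L ∧
          ∃ G' H' : LabeledGraph n d q, wlClass L G' = wlClass L G ∧ wlClass L H' = wlClass L H ∧
            (IsEdgeDeletion G' H' ∨ IsEdgeDeletion H' G' ∨ IsLabelChange G' H')) ∧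
        (∀ P G H : LabeledGraph n d q, T.Adj (wlClass L P) (wlClass L G) →
          T.Adj (wlClass L P) (wlClass L H) → FD L G H ≤ 2 * editBound q L)) ∧
      (∀ k : ℕ, k + 1 ≤ numWLClasses n d q L →
        (coveringNumber (FD L : LabeledGraph n d q → LabeledGraph n d q → ℝ)
            (2 * editBound q L * k) : ℝ) ≤
          (numWLClasses n d q L : ℝ) / ((k : ℝ) + 1))) ∧
    -- generalization part
    (∀ B : ℝ≥0, ∃ C : ℝ, 0 ≤ C ∧
      (∀ (n d : ℕ) (Lφ : ℕ → ℝ≥0) (Lψ : ℝ≥0), 1 ≤ n → 1 ≤ d →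
        ∀ net : SumMPNN L d, net.Admissible Lφ Lψ B → ∀ G H : AttrGraph n d,
          ‖net.embed G - net.embed H‖ ≤
            1 / (n : ℝ) * (C * Lψ * ∏ t ∈ Finset.range L, (Lφ t : ℝ)) * forestDist L G H) ∧
      (∀ (n d q : ℕ) (M' M : ℝ) (Lloss Lfnn Lψ : ℝ≥0) (Lφ : ℕ → ℝ≥0),
        1 ≤ n → 1 ≤ d → 1 ≤ q →
        (∀ y : Bool, LipschitzWith Lloss (fun x => bce x y)) →
        (∀ h ∈ MPNNSum L M' Lfnn Lφ Lψ B n d q, ∀ (G : LabeledGraph n d q) (y : Bool),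
          |bce (h G) y| ≤ M) →
        ∀ (μ : Measure (LabeledGraph n d q × Bool)) [IsProbabilityMeasure μ] (N : ℕ), 1 ≤ N →
        ∀ A : (Fin N → LabeledGraph n d q × Bool) → LabeledGraph n d q → ℝ,
        (∀ S, A S ∈ MPNNSum L M' Lfnn Lφ Lψ B n d q) →
        ∀ δ : ℝ, 0 < δ → δ < 1 →
        ∀ k : ℕ, k + 1 ≤ numWLClasses n d q L →
          1 - δ ≤ (Measure.pi (fun _ : Fin N => μ)).real
            {S | |expLoss μ (A S) - empLoss S (A S)| ≤
              2 * (2 / (n : ℝ) * Lloss * Lfnn *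
                  (C * Lψ * ∏ t ∈ Finset.range L, (Lφ t : ℝ))) * editBound q L * k +
                M * Real.sqrt
                  (((numWLClasses n d q L : ℝ) / ((k : ℝ) + 1) * (4 * Real.log 2) +
                    2 * Real.log (1 / δ)) / (N : ℝ))})) := by
  refine ⟨fun n d q _ hd hq => ⟨fun G H h => FD_le_of_isEdgeDeletion hq h, fun G H h => ?_, ?_,
    fun k hk => ?_⟩, fun B => ⟨(2 * B) ^ L, by positivity, ?_, ?_⟩⟩
  · have h1 := FD_le_of_isLabelChange (L := L) h G.degree_le
    exact ⟨h1, fun e₁ e₂ e₃ => h1.trans (sqrt_two_mul_sum_le_editBound hq hL e₁ e₂ e₃)⟩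
  -- A spanning tree of the edit graph inherits the edit and distance properties of its edges;
  -- vertices with a common neighbor `P` are compared through `P`.
  · obtain ⟨T, hT, htree⟩ := (editGraph_connected hd n q L).exists_isTree_le
    refine ⟨T, htree, fun G H h => editGraph_adj hq hL (hT h), fun P G H h₁ h₂ => ?_⟩
    have h3 := (editGraph_adj hq hL (hT h₁)).1
    have h4 := (editGraph_adj hq hL (hT h₂)).1
    linarith [FD_triangle L G P H, FD_comm L G P]
  · obtain ⟨C, hC, hcover⟩ := exists_FD_cover (n := n) hd hq hL hk
    rw [le_div_iff₀ (by positivity)]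
    exact_mod_cast (Nat.mul_le_mul_right _ (coveringNumber_le hcover)).trans hC
  · intro n d Lφ Lψ _ _ net hnet G H
    exact norm_embed_sub_le hnet G H
  · intro n d q M' M Lloss Lfnn Lψ Lφ _ hd hq hloss hM μ _ N hN A hA δ h0 h1 k hk
    exact generalization_bound hL hd hq hloss hM μ hN hA h0 h1 hk
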